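/- Conventions. Let $(M,J,g)$ be a Hermitian manifold, let $\Omega$ and $T$ be the curvature and the torsion of its Chern connection, and write, in holomorphic coordinates, $$\Theta(g)_{i\bar j}=g^{k\bar l}\,\Omega_{k\bar l i\bar j}+\tfrac12\,g^{m\bar n}g^{p\bar s}\,T_{mp\bar j}\,\overline{T_{ns\bar i}},\qquad T_{mp\bar j}=g_{k\bar j}T^k_{mp}.$$ The flow $\partial_t g_t=-\Theta(g_t)$ is the positive Hermitian curvature flow (HCF$_+$). A Hermitian metric $g$ is HCF$_+$-static if $\Theta(g)=\lambda g$ for some $\lambda\in\mathbb R$. Let $\mathsf G$ be a simply connected complex Lie group with Lie algebra $\mathfrak g$, and let $\operatorname{Der}(\mathfrak g)$ be the space of its complex linear derivations. $\mathsf G$ is perfect if $[\mathfrak g,\mathfrak g]=\mathfrak g$. A left-invariant Hermitian metric $g$ on $\mathsf G$ is a semi-algebraic HCF$_+$-soliton if at the identity $$\Theta(g)=\lambda g+\tfrac12\big(g(D\,\cdot,\cdot)+g(\cdot,D\,\cdot)\big)$$ for some $\lambda\in\mathbb R$ and $D\in\operatorname{Der}(\mathfrak g)$; it is algebraic if $\lambda$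 and $D$ can be chosen such that also the $g$-adjoint $D^*$ lies in $\operatorname{Der}(\mathfrak g)$. Two Hermitian metrics $g,g'$ on $\mathsf G$ are homothetic if $f^*g'=c\,g$ for some biholomorphism $f:\mathsf G\to\mathsf G$ and some constant $c>0$. Theorem. There exist a simply connected complex Lie group $\mathsf H$ that carries a left-invariant HCF$_+$-static metric, and a perfect, simply connected complex Lie group $\mathsf G$ isomorphic to $\mathsf H\ltimes\mathbb C^{\dim_{\mathbb C}\mathsf H}$, where $\mathsf H$ acts on $\mathbb C^{\dim_{\mathbb C}\mathsf H}\cong\operatorname{Lie}(\mathsf H)$ by the adjoint representation, such that $\mathsf G$ admits two left-invariant Hermitian metrics $g_1,g_2$ with the following properties: both are semi-algebraic HCF$_+$-solitons, they are not homothetic, $g_1$ is algebraic, and $g_2$ is not algebraic. -/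

import Mathlib

open scoped Manifold ContDiff ComplexConjugate

noncomputable section

namespace HCF

/-! ### Local Hermitian geometry on an open subset of a complex vector space

A Hermitian metric in a holomorphic chart is a function `h : E → E → E → ℂ`, where
`h y u v = g_y(u, v̄)` is complex linear in `u` and conjugate linear in `v`. -/

section Local

variable {E : Type*} [NormedAddCommGroup E] [NormedSpace ℂ E]

/-- The Wirtinger derivative `∂_u f = (D_u f - i D_{iu} f) / 2`. -/
def dHol (f : E → ℂ) (u : E) (y : E) : ℂ :=
  (fderiv ℝ f y u - Complex.I * fderiv ℝ f y (Complex.I • u)) / 2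

/-- The Wirtinger derivative `∂_{ū} f = (D_u f + i D_{iu} f) / 2`. -/
def dBar (f : E → ℂ) (u : E) (y : E) : ℂ :=
  (fderiv ℝ f y u + Complex.I * fderiv ℝ f y (Complex.I • u)) / 2

/-- The torsion of the Chern connection, with its upper index lowered:
`g(T(u, v), w̄) = ∂_u g(v, w̄) - ∂_v g(u, w̄)` for constant `u`, `v`, `w`, that is
`T_{i j l̄} = ∂_i g_{j l̄} - ∂_j g_{i l̄}`. -/
def chernTorsion (h : E → E → E → ℂ) (y u v w : E) : ℂ :=
  dHol (fun z => h z v w) u y - dHol (fun z => h z u w) v y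

variable [FiniteDimensional ℂ E]

/-- The coordinate vector fields `∂_k` of a system of linear coordinates on `E`. -/
abbrev coordVec (E : Type*) [NormedAddCommGroup E] [NormedSpace ℂ E] [FiniteDimensional ℂ E] :
    Fin (Module.finrank ℂ E) → E :=
  fun k => Module.finBasis ℂ E k

/-- The inverse metric `g^{k l̄}`, determined by `∑ l, g^{k l̄} g_{m l̄} = δ_{k m}`, where
`g_{m l̄} = g(∂_m, ∂_l̄)`. -/
def invMetric (h : E → E → E → ℂ) (y : E) (k l : Fin (Module.finrank ℂ E)) : ℂ :=
  (Matrix.of fun a b => h y (coordVec E a) (coordVec E b))⁻¹ l k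

/-- The curvature of the Chern connection,
`Ω_{i j̄ k l̄} = - ∂_i ∂_j̄ g_{k l̄} + g^{p q̄} ∂_i g_{k q̄} ∂_j̄ g_{p l̄}`,
evaluated as `Ω(u, v̄, w, z̄)`. -/
def chernCurvature (h : E → E → E → ℂ) (y u v w z : E) : ℂ :=
  - dHol (dBar (fun x => h x w z) v) u y
  + ∑ p, ∑ q, invMetric h y p q * dHol (fun x => h x w (coordVec E q)) u y
      * dBar (fun x => h x (coordVec E p) z) v y

/-- The trace `g^{k l̄} Ω_{k l̄ i j̄}` of the Chern curvature over its form indices. -/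
def chernRicci (h : E → E → E → ℂ) (y u v : E) : ℂ :=
  ∑ k, ∑ l, invMetric h y k l * chernCurvature h y (coordVec E k) (coordVec E l) u v

/-- The quadratic torsion term of the positive Hermitian curvature flow,
`(1/2) g^{m n̄} g^{p s̄} T_{m p j̄} T_{n̄ s̄ i}`, where `T_{n̄ s̄ i}` is the complex conjugate of
`T_{n s ī}`. -/
def torsionTerm (h : E → E → E → ℂ) (y u v : E) : ℂ :=
  (1 / 2) * ∑ m, ∑ n, ∑ p, ∑ s, invMetric h y m n * invMetric h y p s
    * chernTorsion h y (coordVec E m) (coordVec E p) v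
    * conj (chernTorsion h y (coordVec E n) (coordVec E s) u)

/-- The torsion-twisted Chern-Ricci curvature `Θ(u, v̄)` in a holomorphic chart. -/
def localTheta (h : E → E → E → ℂ) (y u v : E) : ℂ :=
  chernRicci h y u v + torsionTerm h y u v

end Local

/-! ### Hermitian metrics on complex manifolds -/

section Manifold

variable {E : Type*} [NormedAddCommGroup E] [NormedSpace ℂ E]
  {M : Type*} [TopologicalSpace M] [ChartedSpace E M]

/-- A field of forms on the tangent spaces of `M`, read in the chart around `p`. -/
def inChart (g : ∀ x : M, TangentSpace 𝓘(ℂ, E) x → TangentSpace 𝓘(ℂ, E) x → ℂ)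
    (p : M) (y u v : E) : ℂ :=
  g ((extChartAt 𝓘(ℂ, E) p).symm y)
    (mfderiv 𝓘(ℂ, E) 𝓘(ℂ, E) (extChartAt 𝓘(ℂ, E) p).symm y u)
    (mfderiv 𝓘(ℂ, E) 𝓘(ℂ, E) (extChartAt 𝓘(ℂ, E) p).symm y v)

/-- A smooth Hermitian metric on a complex manifold, as a field of positive definite Hermitian
forms `(u, v) ↦ g_x(u, v̄)` on the tangent spaces (complex linear in `u`, conjugate linear
in `v`). -/
structure HermitianMetric (E : Type*) [NormedAddCommGroup E] [NormedSpace ℂ E]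
    (M : Type*) [TopologicalSpace M] [ChartedSpace E M] where
  form : ∀ x : M, TangentSpace 𝓘(ℂ, E) x → TangentSpace 𝓘(ℂ, E) x → ℂ
  add_left : ∀ x u v w, form x (u + v) w = form x u w + form x v w
  smul_left : ∀ x (c : ℂ) u w, form x (c • u) w = c * form x u w
  conj_symm : ∀ x u v, conj (form x u v) = form x v u
  pos : ∀ x u, u ≠ 0 → 0 < (form x u u).re
  smooth : ∀ (p : M) (u v : E),
    ContDiffOn ℝ ∞ (fun y => inChart form p y u v) (extChartAt 𝓘(ℂ, E) p).target

/-- The torsion-twisted Chern-Ricci curvature `Θ(g)_p(u, v̄)` of a Hermitian metric `g`, computed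
in the holomorphic chart around `p`. -/
def Theta [FiniteDimensional ℂ E] (g : HermitianMetric E M) (p : M)
    (u v : TangentSpace 𝓘(ℂ, E) p) : ℂ :=
  localTheta (inChart g.form p) (extChartAt 𝓘(ℂ, E) p p)
    (mfderiv 𝓘(ℂ, E) 𝓘(ℂ, E) (extChartAt 𝓘(ℂ, E) p) p u)
    (mfderiv 𝓘(ℂ, E) 𝓘(ℂ, E) (extChartAt 𝓘(ℂ, E) p) p v)

/-- `Θ(g) = lam g` for some real constant `lam`. -/
def IsStatic [FiniteDimensional ℂ E] (g : HermitianMetric E M) : Prop :=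
  ∃ lam : ℝ, ∀ (x : M) (u v : TangentSpace 𝓘(ℂ, E) x), Theta g x u v = lam * g.form x u v

/-- Two Hermitian metrics on `M` are homothetic: `f^* g' = c g` for a biholomorphism `f` of `M`
and a constant `c > 0`. -/
def Homothetic (g g' : HermitianMetric E M) : Prop :=
  ∃ (f : Diffeomorph 𝓘(ℂ, E) 𝓘(ℂ, E) M M ω) (c : ℝ), 0 < c ∧
    ∀ (x : M) (u v : TangentSpace 𝓘(ℂ, E) x),
      g'.form (f x) (mfderiv 𝓘(ℂ, E) 𝓘(ℂ, E) f x u) (mfderiv 𝓘(ℂ, E) 𝓘(ℂ, E) f x v)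
        = c * g.form x u v

end Manifold

/-! ### Complex Lie groups -/

section LieGroups

variable {E : Type*} [NormedAddCommGroup E] [NormedSpace ℂ E]
  {G : Type*} [TopologicalSpace G] [ChartedSpace E G] [Group G]

/-- All left translations are isometries of `g`. -/
def IsLeftInvariant (g : HermitianMetric E G) : Prop :=
  ∀ (a x : G) (u v : TangentSpace 𝓘(ℂ, E) x),
    g.form (a * x) (mfderiv 𝓘(ℂ, E) 𝓘(ℂ, E) (fun z => a * z) x u)
      (mfderiv 𝓘(ℂ, E) 𝓘(ℂ, E) (fun z => a * z) x v) = g.form x u v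

/-- The adjoint representation on the Lie algebra `T_1 G` (which is `E` as a vector space): `Ad a`
is the derivative at `1` of `x ↦ a x a⁻¹`. -/
def Ad (a : G) (v : E) : E :=
  mfderiv 𝓘(ℂ, E) 𝓘(ℂ, E) (fun x : G => a * x * a⁻¹) 1 v

/-- `G` is the semidirect product `H ⋉ 𝔥` of `H` and the additive group of its Lie algebra `𝔥`
(a complex vector space of dimension `dim H`), on which `H` acts by the adjoint representation. -/
def IsAdjointSemidirectProduct (E : Type*) [NormedAddCommGroup E] [NormedSpace ℂ E]
    (H : Type*) [TopologicalSpace H] [ChartedSpace E H] [Group H]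
    (F : Type*) [NormedAddCommGroup F] [NormedSpace ℂ F]
    (G : Type*) [TopologicalSpace G] [ChartedSpace F G] [Group G] : Prop :=
  ∃ Φ : Diffeomorph (𝓘(ℂ, E).prod 𝓘(ℂ, E)) 𝓘(ℂ, F) (H × E) G ω,
    ∀ (a b : H) (v w : E), Φ (a, v) * Φ (b, w) = Φ (a * b, v + Ad a w)

variable [CompleteSpace E] [LieGroup 𝓘(ℂ, E) ω G]

/-- A complex Lie group is perfect if its Lie algebra `𝔤` satisfies `[𝔤, 𝔤] = 𝔤`. -/
def IsPerfect (E : Type*) [NormedAddCommGroup E] [NormedSpace ℂ E] [CompleteSpace E]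
    (G : Type*) [TopologicalSpace G] [ChartedSpace E G] [Group G]
    [LieGroup 𝓘(ℂ, E) ω G] : Prop :=
  ⁅(⊤ : LieIdeal ℂ (GroupLieAlgebra 𝓘(ℂ, E) G)),
    (⊤ : LieIdeal ℂ (GroupLieAlgebra 𝓘(ℂ, E) G))⁆ = ⊤

variable [FiniteDimensional ℂ E]

/-- At the identity, `Θ(g) = lam g + (1/2) (g(D ·, ·) + g(·, D ·))`. -/
def SolitonEquation (g : HermitianMetric E G) (lam : ℝ)
    (D : LieDerivation ℂ (GroupLieAlgebra 𝓘(ℂ, E) G) (GroupLieAlgebra 𝓘(ℂ, E) G)) : Prop :=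
  ∀ u v : GroupLieAlgebra 𝓘(ℂ, E) G,
    Theta g 1 u v = lam * g.form 1 u v + (1 / 2) * (g.form 1 (D u) v + g.form 1 u (D v))

/-- A left-invariant Hermitian metric `g` on a (simply connected) complex Lie group is a
semi-algebraic soliton. -/
def IsSemiAlgebraicSoliton (g : HermitianMetric E G) : Prop :=
  IsLeftInvariant g ∧
    ∃ (lam : ℝ) (D : LieDerivation ℂ (GroupLieAlgebra 𝓘(ℂ, E) G) (GroupLieAlgebra 𝓘(ℂ, E) G)),
      SolitonEquation g lam D

/-- A semi-algebraic soliton is algebraic if the `g`-adjoint `D'` of the derivation `D` in the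
soliton equation can be taken to be a derivation as well. -/
def IsAlgebraicSoliton (g : HermitianMetric E G) : Prop :=
  IsLeftInvariant g ∧
    ∃ (lam : ℝ) (D D' : LieDerivation ℂ (GroupLieAlgebra 𝓘(ℂ, E) G) (GroupLieAlgebra 𝓘(ℂ, E) G)),
      SolitonEquation g lam D ∧
        ∀ u v : GroupLieAlgebra 𝓘(ℂ, E) G, g.form 1 (D u) v = g.form 1 u (D' v)

end LieGroups

end HCF

end

/-!
The group `H` is `SL(2, ℂ)`, with Lie algebra `ℂ³` under the cross product, and `G` is its tangent
group `H ⋉ ℂ³`, with the bracket `[(x, v), (y, w)] = (x × y, x × w + v × y)`.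

A left-invariant metric on a complex Lie group has a holomorphic orthonormal coframe, the
Maurer-Cartan form `ω`. Hence its Chern curvature vanishes (`chernCurvature_eq_zero`), and its
torsion is `dω`, which the Maurer-Cartan equation expresses by the Lie bracket. So `Θ` is an
algebraic expression in the structure constants:
`Θ(u, v̄) = (1/2) ∑ i j, g([e i, e j], v̄) g(u, [e i, e j]‾)` for an orthonormal frame `e`
(`LinearRealization.Theta_leftInvariantMetric`). To have these facts for concrete groups, the groups
are realized by operators, where the Maurer-Cartan form is `k⁻¹ dk` and the Lie bracket is the
commutator (`LinearRealization.lieBracket_eq_bracket`).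

On `H` the standard metric of `ℂ³` is static. On `G` consider the metrics `twistMetric t`, in which
the vectors `(e i, t e i)` and `(0, e i)` are orthonormal. By `thetaForm_twist`, the endomorphism
`P` with `Θ(u, v̄) = g(P u, v̄)` is `(x, v) ↦ (x, 2 v)` for `t = 0` and
`(x, v) ↦ (v, 4 v - 2 x)` for `t = 1`. These are solitons with `lam = 1` and the derivations
`D (x, v) = (0, v)`, which is self-adjoint, and `D (x, v) = (0, 2 v)` respectively.

* The second soliton is not algebraic. Otherwise `P - lam` would be a derivation, as it is the
  average of a derivation and its adjoint, but it violates the Leibniz rule on the abelian ideal.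
* The metrics are not homothetic. The derivative of a homothety with factor `c` intertwines `P` for
  `t = 0` and `c P` for `t = 1` (`LinearRealization.exists_linearEquiv_of_homothetic`), but their
  eigenvalues `1, 2` and `2 ± √2` are not proportional.

Simple connectedness of `SL(2, ℂ)` follows from the homeomorphism with `(ℂ² ∖ 0) × ℂ` given by the
first column, and from that of punctured spaces of real dimension at least three.
-/

noncomputable section

namespace HCF

/-! ### Metrics with a holomorphic orthonormal coframe -/

section LocalComputation

open Topology

variable {E W : Type*} [NormedAddCommGroup E] [NormedSpace ℂ E]
  [NormedAddCommGroup W] [InnerProductSpace ℂ W]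

lemma dHol_congr {f g : E → ℂ} {y : E} (h : f =ᶠ[𝓝 y] g) (u : E) : dHol f u y = dHol g u y := by
  simp only [dHol, h.fderiv_eq]

lemma dBar_congr {f g : E → ℂ} {y : E} (h : f =ᶠ[𝓝 y] g) (u : E) : dBar f u y = dBar g u y := by
  simp only [dBar, h.fderiv_eq]

lemma fderiv_real_inner_holomorphic {a b : E → W} {y : E} (ha : DifferentiableAt ℂ a y)
    (hb : DifferentiableAt ℂ b y) (u : E) :
    fderiv ℝ (fun z => inner ℂ (b z) (a z)) y u
      = inner ℂ (b y) (fderiv ℂ a y u) + inner ℂ (fderiv ℂ b y u) (a y) := by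
  have ha' := ha.hasFDerivAt.restrictScalars ℝ
  have hb' := hb.hasFDerivAt.restrictScalars ℝ
  rw [(hb'.inner ℂ ha').fderiv]
  simp [fderivInnerCLM_apply]

/-- Only the argument in which the inner product is linear contributes to the holomorphic
derivative. -/
lemma dHol_inner {a b : E → W} {y : E} (ha : DifferentiableAt ℂ a y)
    (hb : DifferentiableAt ℂ b y) (u : E) :
    dHol (fun z => inner ℂ (b z) (a z)) u y = inner ℂ (b y) (fderiv ℂ a y u) := by
  simp only [dHol, fderiv_real_inner_holomorphic ha hb, map_smul, inner_smul_left,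
    inner_smul_right, Complex.conj_I]
  linear_combination (-(inner ℂ (b y) (fderiv ℂ a y u)) + inner ℂ (fderiv ℂ b y u) (a y)) / 2
    * Complex.I_mul_I

/-- Only the argument in which the inner product is conjugate linear contributes to the
antiholomorphic derivative. -/
lemma dBar_inner {a b : E → W} {y : E} (ha : DifferentiableAt ℂ a y)
    (hb : DifferentiableAt ℂ b y) (u : E) :
    dBar (fun z => inner ℂ (b z) (a z)) u y = inner ℂ (fderiv ℂ b y u) (a y) := by
  simp only [dBar, fderiv_real_inner_holomorphic ha hb, map_smul, inner_smul_left,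
    inner_smul_right, Complex.conj_I]
  linear_combination ((inner ℂ (b y) (fderiv ℂ a y u)) - inner ℂ (fderiv ℂ b y u) (a y)) / 2
    * Complex.I_mul_I

lemma fderiv_clm_apply_const {A : E → E →L[ℂ] W} {y : E} (hA : DifferentiableAt ℂ A y) (w u : E) :
    fderiv ℂ (fun z => A z w) y u = fderiv ℂ A y u w := by
  rw [fderiv_clm_apply hA (differentiableAt_const w)]
  simp

lemma eventually_differentiableAt {A : E → E →L[ℂ] W} {y₀ : E}
    (hA : ContDiffAt ℂ 2 A y₀) :
    ∀ᶠ y in 𝓝 y₀, DifferentiableAt ℂ A y :=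
  (hA.eventually (by simp)).mono fun _ hy => hy.differentiableAt (by simp)

variable {h : E → E → E → ℂ} {y₀ : E} {A : E → E →L[ℂ] W}

lemma dHol_of_coframe (hA : ContDiffAt ℂ 2 A y₀)
    (hh : ∀ᶠ y in 𝓝 y₀, ∀ u v, h y u v = inner ℂ (A y v) (A y u)) (u v w : E) :
    dHol (fun z => h z v w) u y₀ = inner ℂ (A y₀ w) (fderiv ℂ A y₀ u v) := by
  have hd := hA.differentiableAt (by simp)
  rw [dHol_congr (hh.mono fun y hy => hy v w), dHol_inner, fderiv_clm_apply_const hd] <;>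
  exact hd.clm_apply (differentiableAt_const _)

lemma dBar_of_coframe (hA : DifferentiableAt ℂ A y₀)
    (hh : ∀ᶠ y in 𝓝 y₀, ∀ u v, h y u v = inner ℂ (A y v) (A y u)) (u v w : E) :
    dBar (fun z => h z v w) u y₀ = inner ℂ (fderiv ℂ A y₀ u w) (A y₀ v) := by
  rw [dBar_congr (hh.mono fun y hy => hy v w), dBar_inner, fderiv_clm_apply_const hA] <;>
  exact hA.clm_apply (differentiableAt_const _)

variable [FiniteDimensional ℂ E]

/-- Contraction with the inverse metric in linear coordinates is a trace over an
orthonormal basis. -/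
lemma sum_invMetric_mul {ι : Type*} [Fintype ι] [DecidableEq ι] {h : E → E → E → ℂ} {y : E}
    (A : E ≃ₗ[ℂ] W) (hh : ∀ u v, h y u v = inner ℂ (A v) (A u)) (o : OrthonormalBasis ι ℂ W)
    (f g : W →ₗ[ℂ] ℂ) :
    ∑ k, ∑ l, invMetric h y k l * (f (A (coordVec E k)) * conj (g (A (coordVec E l))))
      = ∑ i, f (o i) * conj (g (o i)) := by
  let b : Module.Basis (Fin (Module.finrank ℂ E)) ℂ W := (Module.finBasis ℂ E).map A
  have hb : ∀ k, b k = A (coordVec E k) := fun k => by simp [b]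
  let C := (o.toBasis.toMatrix b).transpose
  let D := (b.toMatrix o.toBasis).transpose
  have hDC : D * C = 1 := by
    simp only [C, D, ← Matrix.transpose_mul, Module.Basis.toMatrix_mul_toMatrix_flip,
      Matrix.transpose_one]
  have hCD : C * D = 1 := by
    simp only [C, D, ← Matrix.transpose_mul, Module.Basis.toMatrix_mul_toMatrix_flip,
      Matrix.transpose_one]
  -- with `C` the coordinates of the frame in the orthonormal basis, the Gram matrix is `C Cᴴ`
  have hGr : (Matrix.of fun p q => h y (coordVec E p) (coordVec E q)) = C * C.conjTranspose := by
    ext p q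
    simp only [Matrix.of_apply, hh, Matrix.mul_apply, C, Matrix.transpose_apply,
      Matrix.conjTranspose_apply, Module.Basis.toMatrix_apply, o.coe_toBasis_repr_apply,
      o.repr_apply_apply, hb]
    rw [← o.sum_inner_mul_inner]
    refine Finset.sum_congr rfl fun i _ => ?_
    rw [RCLike.star_def, inner_conj_symm, mul_comm]
  have hinv : ∀ k l, invMetric h y k l = ∑ i, D i k * conj (D i l) := by
    intro k l
    have : (Matrix.of fun p q => h y (coordVec E p) (coordVec E q))⁻¹ = D.conjTranspose * D := by
      apply Matrix.inv_eq_right_inv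
      rw [hGr, Matrix.mul_assoc, ← Matrix.mul_assoc C.conjTranspose, ← Matrix.conjTranspose_mul,
        hDC, Matrix.conjTranspose_one, Matrix.one_mul, hCD]
    rw [invMetric, this, Matrix.mul_apply]
    refine Finset.sum_congr rfl fun i _ => ?_
    rw [Matrix.conjTranspose_apply, RCLike.star_def, mul_comm]
  have ho : ∀ i, o i = ∑ k, D i k • A (coordVec E k) := by
    intro i
    have := b.sum_toMatrix_smul_self o.toBasis i
    simp only [hb, o.coe_toBasis] at this
    rw [← this]
    simp [D, Matrix.transpose_apply]
  have hf : ∀ i, f (o i) = ∑ k, D i k * f (A (coordVec E k)) := fun i => by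
    conv_lhs => rw [ho i]
    simp
  have hg : ∀ i, conj (g (o i)) = ∑ k, conj (D i k) * conj (g (A (coordVec E k))) := fun i => by
    conv_lhs => rw [ho i]
    simp
  simp only [hf, hg, Finset.sum_mul_sum]
  simp only [hinv, Finset.sum_mul]
  symm
  rw [Finset.sum_comm]
  refine Finset.sum_congr rfl fun k _ => ?_
  rw [Finset.sum_comm]
  refine Finset.sum_congr rfl fun l _ => Finset.sum_congr rfl fun i _ => ?_
  ring

/-- A metric with a holomorphic orthonormal coframe `A` is Chern flat: both terms of the curvature
equal `⟪∂_v A z, ∂_u A w⟫`. -/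
lemma chernCurvature_eq_zero (hA : ContDiffAt ℂ 2 A y₀)
    (hh : ∀ᶠ y in 𝓝 y₀, ∀ u v, h y u v = inner ℂ (A y v) (A y u))
    (hb : Function.Bijective (A y₀)) (u v w z : E) : chernCurvature h y₀ u v w z = 0 := by
  have hd := hA.differentiableAt (by simp)
  have hdd : DifferentiableAt ℂ (fderiv ℂ A) y₀ :=
    (hA.fderiv_right (m := 1) (by norm_num)).differentiableAt (by simp)
  have h1 : dBar (fun x => h x w z) v =ᶠ[𝓝 y₀] fun y => inner ℂ (fderiv ℂ A y v z) (A y w) := by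
    filter_upwards [eventually_differentiableAt hA, hh.eventually_nhds] with y hy hy'
    exact dBar_of_coframe hy hy' v w z
  have h2 : dHol (dBar (fun x => h x w z) v) u y₀
      = inner ℂ (fderiv ℂ A y₀ v z) (fderiv ℂ A y₀ u w) := by
    rw [dHol_congr h1, dHol_inner, fderiv_clm_apply_const hd]
    · exact hd.clm_apply (differentiableAt_const _)
    · exact (hdd.clm_apply (differentiableAt_const _)).clm_apply (differentiableAt_const _)
  let e : E ≃ₗ[ℂ] W := LinearEquiv.ofBijective (A y₀ : E →ₗ[ℂ] W) hb
  have : FiniteDimensional ℂ W := e.finiteDimensional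
  let o := stdOrthonormalBasis ℂ W
  have h3 := sum_invMetric_mul (h := h) (y := y₀) e (fun u v => hh.self_of_nhds u v) o
    (innerₛₗ ℂ (fderiv ℂ A y₀ v z)) (innerₛₗ ℂ (fderiv ℂ A y₀ u w))
  simp only [innerₛₗ_apply_apply, inner_conj_symm, o.sum_inner_mul_inner] at h3
  rw [chernCurvature, h2, ← h3, neg_add_eq_zero]
  refine Finset.sum_congr rfl fun k _ => Finset.sum_congr rfl fun l _ => ?_
  rw [dHol_of_coframe hA hh, dBar_of_coframe hd hh, mul_assoc]
  congr 1
  exact mul_comm _ _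

/-- For a metric with a holomorphic orthonormal coframe `A`, only the torsion term of `Θ` survives,
and the torsion is the exterior derivative of `A`, here expressed by a bilinear map `c` (the
structure equation). -/
lemma localTheta_of_coframe {ι : Type*} [Fintype ι] (hA : ContDiffAt ℂ 2 A y₀)
    (hh : ∀ᶠ y in 𝓝 y₀, ∀ u v, h y u v = inner ℂ (A y v) (A y u))
    (hb : Function.Bijective (A y₀)) (c : W →ₗ[ℂ] W →ₗ[ℂ] W)
    (hc : ∀ u v, fderiv ℂ A y₀ u v - fderiv ℂ A y₀ v u = c (A y₀ u) (A y₀ v))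
    (o : OrthonormalBasis ι ℂ W) (u v : E) :
    localTheta h y₀ u v = (1 / 2) * ∑ i, ∑ j,
      inner ℂ (A y₀ v) (c (o i) (o j)) * inner ℂ (c (o i) (o j)) (A y₀ u) := by
  classical
  let e : E ≃ₗ[ℂ] W := LinearEquiv.ofBijective (A y₀ : E →ₗ[ℂ] W) hb
  have he : ∀ x, e x = A y₀ x := fun _ => rfl
  have hT : ∀ x y z, chernTorsion h y₀ x y z = inner ℂ (A y₀ z) (c (e x) (e y)) := fun x y z => by
    rw [chernTorsion, dHol_of_coframe hA hh, dHol_of_coframe hA hh, ← inner_sub_right, hc]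
    rfl
  have hs := fun f g => sum_invMetric_mul (h := h) (y := y₀) e
    (fun u v => hh.self_of_nhds u v) o f g
  have hR : chernRicci h y₀ u v = 0 := by
    simp [chernRicci, chernCurvature_eq_zero hA hh hb]
  rw [localTheta, hR, zero_add, torsionTerm]
  congr 1
  calc _ = ∑ m, ∑ n, invMetric h y₀ m n * ∑ p, ∑ s, invMetric h y₀ p s *
        (inner ℂ (A y₀ v) (c (e (coordVec E m)) (e (coordVec E p)))
          * conj (inner ℂ (A y₀ u) (c (e (coordVec E n)) (e (coordVec E s))))) := by
        simp only [hT, Finset.mul_sum, mul_assoc]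
    _ = ∑ m, ∑ n, invMetric h y₀ m n * ∑ j,
        (inner ℂ (A y₀ v) (c (e (coordVec E m)) (o j))
          * conj (inner ℂ (A y₀ u) (c (e (coordVec E n)) (o j)))) := by
        refine Finset.sum_congr rfl fun m _ => Finset.sum_congr rfl fun n _ => ?_
        congr 1
        exact hs (innerₛₗ ℂ (A y₀ v) ∘ₗ c (e (coordVec E m)))
          (innerₛₗ ℂ (A y₀ u) ∘ₗ c (e (coordVec E n)))
    _ = ∑ j, ∑ m, ∑ n, invMetric h y₀ m n *
        (inner ℂ (A y₀ v) (c (e (coordVec E m)) (o j))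
          * conj (inner ℂ (A y₀ u) (c (e (coordVec E n)) (o j)))) := by
        simp only [Finset.mul_sum]
        symm
        rw [Finset.sum_comm]
        refine Finset.sum_congr rfl fun m _ => ?_
        rw [Finset.sum_comm]
    _ = ∑ j, ∑ i, inner ℂ (A y₀ v) (c (o i) (o j)) * conj (inner ℂ (A y₀ u) (c (o i) (o j))) := by
        refine Finset.sum_congr rfl fun j _ => ?_
        exact hs (innerₛₗ ℂ (A y₀ v) ∘ₗ c.flip (o j)) (innerₛₗ ℂ (A y₀ u) ∘ₗ c.flip (o j))
    _ = _ := by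
        rw [Finset.sum_comm]
        simp only [inner_conj_symm]

end LocalComputation

/-! ### Realizations of complex Lie groups and the Maurer-Cartan equation -/

section MaurerCartan

open Topology

variable {E : Type*} [NormedAddCommGroup E] [NormedSpace ℂ E]
  {G : Type*} [TopologicalSpace G] [ChartedSpace E G] [Group G]
  {R : Type*} [NormedRing R] [NormedAlgebra ℂ R]

section MDeriv

variable {E' : Type*} [NormedAddCommGroup E'] [NormedSpace ℂ E']
  {E'' : Type*} [NormedAddCommGroup E''] [NormedSpace ℂ E'']
  {M : Type*} [TopologicalSpace M] [ChartedSpace E M]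
  {M' : Type*} [TopologicalSpace M'] [ChartedSpace E' M']
  {M'' : Type*} [TopologicalSpace M''] [ChartedSpace E'' M'']

/-- The manifold derivative, as a continuous linear map between the model spaces instead of the
tangent spaces (which are the model spaces by definition). -/
def mderiv (E E' : Type*) [NormedAddCommGroup E] [NormedSpace ℂ E]
    [NormedAddCommGroup E'] [NormedSpace ℂ E'] {M : Type*} [TopologicalSpace M] [ChartedSpace E M]
    {M' : Type*} [TopologicalSpace M'] [ChartedSpace E' M'] (f : M → M') (x : M) : E →L[ℂ] E' :=
  mfderiv 𝓘(ℂ, E) 𝓘(ℂ, E') f x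

lemma mderiv_comp {g : M' → M''} {f : M → M'} {x : M}
    (hg : MDifferentiableAt 𝓘(ℂ, E') 𝓘(ℂ, E'') g (f x))
    (hf : MDifferentiableAt 𝓘(ℂ, E) 𝓘(ℂ, E') f x) (u : E) :
    mderiv E E'' (fun z => g (f z)) x u = mderiv E' E'' g (f x) (mderiv E E' f x u) :=
  congrArg (fun (F : E →L[ℂ] E'') => F u) (mfderiv_comp x hg hf)

lemma mderiv_eq_fderiv (f : E → E') (x : E) : mderiv E E' f x = fderiv ℂ f x :=
  mfderiv_eq_fderiv

lemma mderiv_id (x : M) (u : E) : mderiv E E (fun z : M => z) x u = u :=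
  congrArg (fun (F : E →L[ℂ] E) => F u) (mfderiv_id (I := 𝓘(ℂ, E)) (x := x))

end MDeriv

/-- A holomorphic homomorphism `toHom` from a complex Lie group `G` to the multiplicative monoid of
a normed algebra `R`, together with a continuous left inverse `coord` of its derivative `lie` at
the identity. It turns derivatives of left translations into products in `R`. -/
structure LinearRealization (E : Type*) [NormedAddCommGroup E] [NormedSpace ℂ E]
    (G : Type*) [TopologicalSpace G] [ChartedSpace E G] [Group G]
    (R : Type*) [NormedRing R] [NormedAlgebra ℂ R] where
  toHom : G →* R
  lie : E →L[ℂ] R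
  coord : R →L[ℂ] E
  contMDiff : ContMDiff 𝓘(ℂ, E) 𝓘(ℂ, R) ω toHom
  mderiv_one : mderiv E R toHom 1 = lie
  coord_lie : ∀ v, coord (lie v) = v

namespace LinearRealization

variable (r : LinearRealization E G R)

/-- The commutator in `R`, transported to the Lie algebra `E`. -/
def bracket (x y : E) : E := r.coord (r.lie x * r.lie y - r.lie y * r.lie x)

/-- The logarithmic derivative `k⁻¹ dk` of a map `k` into the group: the pullback under `k` of the
Maurer-Cartan form. -/
def logDeriv (k : E → G) (y : E) : E →L[ℂ] E :=
  r.coord ∘L ContinuousLinearMap.mul ℂ R (r.toHom (k y)⁻¹) ∘L fderiv ℂ (fun z => r.toHom (k z)) y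

lemma contDiffAt_comp {k : E → G} {y : E} (hk : ContMDiffAt 𝓘(ℂ, E) 𝓘(ℂ, E) ω k y) :
    ContDiffAt ℂ ω (fun z => r.toHom (k z)) y :=
  contMDiffAt_iff_contDiffAt.1 ((r.contMDiff (k y)).comp y hk)

/-- The Maurer-Cartan form: left translation of tangent vectors at `x` to the identity. -/
def toOne (x : G) : E →L[ℂ] E := mderiv E E (fun z : G => x⁻¹ * z) x

variable [LieGroup 𝓘(ℂ, E) ω G]

lemma mdifferentiableAt_mul_left (a x : G) :
    MDifferentiableAt 𝓘(ℂ, E) 𝓘(ℂ, E) (fun z : G => a * z) x :=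
  (contMDiff_mul_left (I := 𝓘(ℂ, E)) (n := ω) (a := a)).mdifferentiableAt (by simp)

lemma lie_toOne_mderiv {k : E → G} {y : E} (hk : MDifferentiableAt 𝓘(ℂ, E) 𝓘(ℂ, E) k y) (u : E) :
    r.lie (toOne (E := E) (k y) (mderiv E E k y u))
      = r.toHom (k y)⁻¹ * fderiv ℂ (fun z => r.toHom (k z)) y u := by
  have hm := mdifferentiableAt_mul_left (E := E) (k y)⁻¹ (k y)
  have hd : ∀ x, MDifferentiableAt 𝓘(ℂ, E) 𝓘(ℂ, R) r.toHom x :=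
    r.contMDiff.mdifferentiable (by simp)
  have hK : DifferentiableAt ℂ (fun z => r.toHom (k z)) y :=
    ((hd _).comp y hk).differentiableAt
  have h1 : mderiv E R r.toHom ((k y)⁻¹ * k y) = r.lie := by
    rw [inv_mul_cancel, r.mderiv_one]
  have h2 := mderiv_comp (f := fun z => (k y)⁻¹ * k z) (hd _) (hm.comp y hk) u
  rw [toOne, ← mderiv_comp hm hk, ← h1, ← h2]
  simp only [map_mul]
  rw [mderiv_eq_fderiv, fderiv_const_mul hK]
  rfl

lemma toOne_mderiv {k : E → G} {y : E} (hk : MDifferentiableAt 𝓘(ℂ, E) 𝓘(ℂ, E) k y) (u : E) :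
    toOne (E := E) (k y) (mderiv E E k y u) = r.logDeriv k y u := by
  rw [← r.coord_lie (toOne _ _), r.lie_toOne_mderiv hk]
  rfl

lemma fderiv_eq_mul_lie {k : E → G} {y : E} (hk : MDifferentiableAt 𝓘(ℂ, E) 𝓘(ℂ, E) k y) (u : E) :
    fderiv ℂ (fun z => r.toHom (k z)) y u = r.toHom (k y) * r.lie (r.logDeriv k y u) := by
  rw [← r.toOne_mderiv hk, r.lie_toOne_mderiv hk, ← mul_assoc, ← map_mul, mul_inv_cancel,
    map_one, one_mul]

lemma contDiffAt_logDeriv {k : E → G} {y : E} (hk : ContMDiffAt 𝓘(ℂ, E) 𝓘(ℂ, E) ω k y) :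
    ContDiffAt ℂ ω (r.logDeriv k) y := by
  have h1 := r.contDiffAt_comp (hk.inv (I := 𝓘(ℂ, E)))
  have h2 := (r.contDiffAt_comp hk).fderiv_right (m := ω) le_rfl
  exact contDiffAt_const.clm_comp
    ((((ContinuousLinearMap.mul ℂ R).contDiff.contDiffAt).comp y h1).clm_comp h2)

/-- The Maurer-Cartan equation `dω(u, v) = -[ω(u), ω(v)]`, from the symmetry of the second
derivative of `toHom ∘ k`. -/
theorem maurerCartan {k : E → G} {y : E} (hk : ContMDiffAt 𝓘(ℂ, E) 𝓘(ℂ, E) ω k y) (u v : E) :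
    fderiv ℂ (r.logDeriv k) y u v - fderiv ℂ (r.logDeriv k) y v u
      = - r.bracket (r.logDeriv k y u) (r.logDeriv k y v) := by
  set K : E → R := fun z => r.toHom (k z) with hKdef
  have hev : ∀ᶠ z in 𝓝 y, ContMDiffAt 𝓘(ℂ, E) 𝓘(ℂ, E) ω k z :=
    (contMDiffAt_iff_contMDiffAt_nhds (by simp)).1 hk
  have hd : ∀ᶠ z in 𝓝 y, MDifferentiableAt 𝓘(ℂ, E) 𝓘(ℂ, E) k z :=
    hev.mono fun z hz => hz.mdifferentiableAt (by simp)
  have hK : ContDiffAt ℂ ω K y := r.contDiffAt_comp hk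
  have hK' : DifferentiableAt ℂ (fderiv ℂ K) y :=
    (hK.fderiv_right (m := ω) le_rfl).differentiableAt (by simp)
  have hKd : DifferentiableAt ℂ K y := hK.differentiableAt (by simp)
  have hL : DifferentiableAt ℂ (r.logDeriv k) y :=
    (r.contDiffAt_logDeriv hk).differentiableAt (by simp)
  have key : ∀ u v, fderiv ℂ (fderiv ℂ K) y u v
      = K y * (r.lie (r.logDeriv k y u) * r.lie (r.logDeriv k y v))
        + K y * r.lie (fderiv ℂ (r.logDeriv k) y u v) := by
    intro u v
    have h1 : (fun z => fderiv ℂ K z v) =ᶠ[𝓝 y] fun z => K z * r.lie (r.logDeriv k z v) :=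
      hd.mono fun z hz => r.fderiv_eq_mul_lie hz v
    have h2 := congrArg (fun f : E →L[ℂ] R => f u) h1.fderiv_eq
    have hLv : DifferentiableAt ℂ (fun z => r.logDeriv k z v) y :=
      hL.clm_apply (differentiableAt_const v)
    have h3 : HasFDerivAt (fun z => r.lie (r.logDeriv k z v))
        (r.lie ∘L fderiv ℂ (fun z => r.logDeriv k z v) y) y :=
      r.lie.hasFDerivAt.comp y hLv.hasFDerivAt
    rw [fderiv_clm_apply hK' (differentiableAt_const v)] at h2
    have h6 : fderiv ℂ (fun z => K z * r.lie (r.logDeriv k z v)) y = _ :=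
      (hKd.hasFDerivAt.mul' h3).fderiv
    rw [h6, fderiv_clm_apply hL (differentiableAt_const v)] at h2
    have h4 := r.fderiv_eq_mul_lie (hk.mdifferentiableAt (by simp)) u
    simp only [← hKdef] at h4
    simpa [h4, add_comm, mul_assoc] using h2
  have hsymm : fderiv ℂ (fderiv ℂ K) y u v = fderiv ℂ (fderiv ℂ K) y v u :=
    (hK.isSymmSndFDerivAt (by simp)) u v
  rw [key u v, key v u] at hsymm
  have hinv : r.toHom (k y)⁻¹ * K y = 1 := by
    rw [hKdef, ← map_mul, inv_mul_cancel, map_one]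
  have h5 := congrArg (fun x => r.toHom (k y)⁻¹ * x) hsymm
  simp only [mul_add, ← mul_assoc, hinv, one_mul] at h5
  rw [← r.coord_lie (_ - _), map_sub, bracket, ← map_neg]
  congr 1
  rw [sub_eq_iff_eq_add, ← sub_eq_zero]
  rw [← sub_eq_zero] at h5
  rw [← h5]
  abel

end LinearRealization

end MaurerCartan

/-! ### The Lie bracket of a realized group -/

section LieBracket

open Topology

variable {E : Type*} [NormedAddCommGroup E] [NormedSpace ℂ E]
  {G : Type*} [TopologicalSpace G] [ChartedSpace E G] [Group G]
  {R : Type*} [NormedRing R] [NormedAlgebra ℂ R]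

namespace LinearRealization

lemma toOne_one (u : E) : toOne (E := E) (1 : G) u = u := by
  rw [toOne]
  simp only [inv_one, one_mul]
  exact mderiv_id _ _

variable [LieGroup 𝓘(ℂ, E) ω G]

lemma toOne_mderiv_mul_left (x : G) (a : E) :
    toOne (E := E) x (mderiv E E (fun z : G => x * z) 1 a) = a := by
  have h : toOne (E := E) x = mderiv E E (fun z : G => x⁻¹ * z) (x * 1) := by
    rw [mul_one, toOne]
  rw [h, ← mderiv_comp (mdifferentiableAt_mul_left _ _) (mdifferentiableAt_mul_left _ _)]
  simp only [inv_mul_cancel_left]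
  exact mderiv_id _ _

lemma mderiv_mul_left_toOne (x : G) (a : E) :
    mderiv E E (fun z : G => x * z) 1 (toOne (E := E) x a) = a := by
  have h : mderiv E E (fun z : G => x * z) 1 = mderiv E E (fun z : G => x * z) (x⁻¹ * x) := by
    rw [inv_mul_cancel]
  rw [h, toOne, ← mderiv_comp (mdifferentiableAt_mul_left _ _) (mdifferentiableAt_mul_left _ _)]
  simp only [mul_inv_cancel_left]
  exact mderiv_id _ _

lemma toOne_mul (a x : G) (u : E) :
    toOne (E := E) (a * x) (mderiv E E (fun z : G => a * z) x u) = toOne (E := E) x u := by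
  rw [toOne, ← mderiv_comp (mdifferentiableAt_mul_left _ _) (mdifferentiableAt_mul_left _ _), toOne]
  simp only [mul_inv_rev, mul_assoc, inv_mul_cancel_left]

/-- Left translation of tangent vectors to the identity, as an isomorphism. -/
def toOneEquiv (x : G) : E ≃L[ℂ] E :=
  ContinuousLinearEquiv.equivOfInverse (toOne (E := E) x) (mderiv E E (fun z : G => x * z) 1)
    (mderiv_mul_left_toOne x) (toOne_mderiv_mul_left x)

lemma contMDiffAt_chart_symm (p : G) {y : E} (hy : y ∈ (extChartAt 𝓘(ℂ, E) p).target) :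
    ContMDiffAt 𝓘(ℂ, E) 𝓘(ℂ, E) ω (extChartAt 𝓘(ℂ, E) p).symm y :=
  (contMDiffOn_extChartAt_symm (I := 𝓘(ℂ, E)) (n := ω) p).contMDiffAt
    ((isOpen_extChartAt_target p).mem_nhds hy)

lemma isInvertible_mderiv_chart_symm (p : G) {y : E} (hy : y ∈ (extChartAt 𝓘(ℂ, E) p).target) :
    (mderiv E E (extChartAt 𝓘(ℂ, E) p).symm y).IsInvertible := by
  have : IsManifold 𝓘(ℂ, E) 1 G := IsManifold.of_le (n := ω) le_top
  have h := isInvertible_mfderivWithin_extChartAt_symm (I := 𝓘(ℂ, E)) hy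
  have hs : ∀ s : Set E, s = Set.univ →
    (mfderivWithin 𝓘(ℂ, E) 𝓘(ℂ, E) (extChartAt 𝓘(ℂ, E) p).symm s y : E →L[ℂ] E)
      = mderiv E E (extChartAt 𝓘(ℂ, E) p).symm y := by
    rintro _ rfl
    exact congrFun (mfderivWithin_univ (I := 𝓘(ℂ, E)) (I' := 𝓘(ℂ, E))
      (f := (extChartAt 𝓘(ℂ, E) p).symm)) _
  rw [← hs _ (ModelWithCorners.range_eq_univ 𝓘(ℂ, E))]
  exact h

lemma mderiv_chart_self (p : G) (u : E) :
    mderiv E E (extChartAt 𝓘(ℂ, E) p) p u = u := by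
  have : IsManifold 𝓘(ℂ, E) 1 G := IsManifold.of_le (n := ω) le_top
  exact congrArg (fun (F : E →L[ℂ] E) => F u) (mfderiv_extChartAt_self (I := 𝓘(ℂ, E)) (x := p))

lemma mderiv_chart_symm_self (p : G) (u : E) :
    mderiv E E (extChartAt 𝓘(ℂ, E) p).symm (extChartAt 𝓘(ℂ, E) p p) u = u := by
  have : IsManifold 𝓘(ℂ, E) 1 G := IsManifold.of_le (n := ω) le_top
  have hs : ∀ s : Set E, s = Set.univ →
    (mfderivWithin 𝓘(ℂ, E) 𝓘(ℂ, E) (extChartAt 𝓘(ℂ, E) p).symm s (extChartAt 𝓘(ℂ, E) p p) :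
        E →L[ℂ] E)
      = mderiv E E (extChartAt 𝓘(ℂ, E) p).symm (extChartAt 𝓘(ℂ, E) p p) := by
    rintro _ rfl
    exact congrFun (mfderivWithin_univ (I := 𝓘(ℂ, E)) (I' := 𝓘(ℂ, E))
      (f := (extChartAt 𝓘(ℂ, E) p).symm)) _
  rw [← hs _ (ModelWithCorners.range_eq_univ 𝓘(ℂ, E))]
  exact congrArg (fun (F : E →L[ℂ] E) => F u)
    (mfderivWithin_range_extChartAt_symm (I := 𝓘(ℂ, E)) (x := p))

variable (r : LinearRealization E G R)

lemma logDeriv_chart_symm (p : G) {y : E} (hy : y ∈ (extChartAt 𝓘(ℂ, E) p).target) (u : E) :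
    r.logDeriv (extChartAt 𝓘(ℂ, E) p).symm y u
      = toOne (E := E) ((extChartAt 𝓘(ℂ, E) p).symm y)
          (mderiv E E (extChartAt 𝓘(ℂ, E) p).symm y u) :=
  (r.toOne_mderiv ((contMDiffAt_chart_symm p hy).mdifferentiableAt (by simp)) u).symm

lemma logDeriv_chart_symm_self (p : G) (u : E) :
    r.logDeriv (extChartAt 𝓘(ℂ, E) p).symm (extChartAt 𝓘(ℂ, E) p p) u = toOne (E := E) p u := by
  rw [logDeriv_chart_symm r p (mem_extChartAt_target p), mderiv_chart_symm_self,
    extChartAt_to_inv]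

lemma isInvertible_logDeriv (p : G) {y : E} (hy : y ∈ (extChartAt 𝓘(ℂ, E) p).target) :
    (r.logDeriv (extChartAt 𝓘(ℂ, E) p).symm y).IsInvertible := by
  obtain ⟨e, he⟩ := isInvertible_mderiv_chart_symm p hy
  refine ⟨e.trans (toOneEquiv ((extChartAt 𝓘(ℂ, E) p).symm y)), ?_⟩
  ext u
  rw [logDeriv_chart_symm r p hy, ← he]
  rfl

/-- The Lie bracket of left-invariant vector fields is the commutator in the realization. The
left-invariant field `X a` is characterized by `ω (X a) = a`, which is differentiated and compared
with the Maurer-Cartan equation. -/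
theorem lieBracket_eq_bracket [CompleteSpace E] (a b : E) :
    Bracket.bracket (L := GroupLieAlgebra 𝓘(ℂ, E) G) (M := GroupLieAlgebra 𝓘(ℂ, E) G) a b =
      r.bracket a b := by
  set φ := extChartAt 𝓘(ℂ, E) (1 : G) with hφ
  set y₀ := φ 1
  let X : E → E → E := fun a y =>
    (mderiv E E φ.symm y).inverse (mderiv E E (fun z : G => φ.symm y * z) 1 a)
  have hpull : ∀ a : E, ∀ s : Set E, s = Set.univ →
      (VectorField.mpullbackWithin 𝓘(ℂ, E) 𝓘(ℂ, E) φ.symm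
        (mulInvariantVectorField (I := 𝓘(ℂ, E)) (G := G) a) s : E → E) = X a := by
    rintro a _ rfl
    rw [VectorField.mpullbackWithin_univ]
    rfl
  have hbr : Bracket.bracket (L := GroupLieAlgebra 𝓘(ℂ, E) G)
      (M := GroupLieAlgebra 𝓘(ℂ, E) G) a b = VectorField.lieBracket ℂ (X a) (X b) y₀ := by
    have h1 : mderiv E E φ (1 : G) = ContinuousLinearMap.id ℂ E := by
      ext u
      exact mderiv_chart_self 1 u
    have h2 : Bracket.bracket (L := GroupLieAlgebra 𝓘(ℂ, E) G)
        (M := GroupLieAlgebra 𝓘(ℂ, E) G) a b = (mderiv E E φ (1 : G)).inverse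
        (VectorField.lieBracketWithin ℂ
          (VectorField.mpullbackWithin 𝓘(ℂ, E) 𝓘(ℂ, E) φ.symm
            (mulInvariantVectorField (I := 𝓘(ℂ, E)) (G := G) a) (Set.range 𝓘(ℂ, E)) : E → E)
          (VectorField.mpullbackWithin 𝓘(ℂ, E) 𝓘(ℂ, E) φ.symm
            (mulInvariantVectorField (I := 𝓘(ℂ, E)) (G := G) b) (Set.range 𝓘(ℂ, E)) : E → E)
          (φ.symm ⁻¹' Set.univ ∩ Set.range 𝓘(ℂ, E)) y₀) := rfl
    rw [h2, hpull a _ (ModelWithCorners.range_eq_univ 𝓘(ℂ, E)),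
      hpull b _ (ModelWithCorners.range_eq_univ 𝓘(ℂ, E)), h1, ContinuousLinearMap.inverse_id,
      ModelWithCorners.range_eq_univ, Set.preimage_univ, Set.univ_inter,
      VectorField.lieBracketWithin_univ]
    rfl
  have hy₀ : y₀ ∈ φ.target := mem_extChartAt_target 1
  have hev : ∀ᶠ y in 𝓝 y₀, y ∈ φ.target := (isOpen_extChartAt_target 1).mem_nhds hy₀
  have hω := (r.contDiffAt_logDeriv (contMDiffAt_chart_symm (1 : G) hy₀))
  have hωd : DifferentiableAt ℂ (r.logDeriv φ.symm) y₀ := hω.differentiableAt (by simp)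
  have hX : ∀ a y, y ∈ φ.target → r.logDeriv φ.symm y (X a y) = a := by
    intro a y hy
    obtain ⟨e, he⟩ := isInvertible_mderiv_chart_symm (1 : G) hy
    rw [logDeriv_chart_symm r 1 hy, ← hφ]
    simp only [X, hφ, ← he, ContinuousLinearMap.inverse_equiv]
    simp only [ContinuousLinearEquiv.coe_coe, ContinuousLinearEquiv.apply_symm_apply]
    exact toOne_mderiv_mul_left _ _
  have hX' : ∀ a, ∀ y ∈ φ.target, X a y = (r.logDeriv φ.symm y).inverse a := by
    intro a y hy
    obtain ⟨e, he⟩ := isInvertible_logDeriv r (1 : G) hy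
    have := hX a y hy
    rw [hφ, ← he] at this ⊢
    rw [ContinuousLinearMap.inverse_equiv]
    exact (e.symm_apply_eq.2 this.symm).symm
  have hXd : ∀ a, DifferentiableAt ℂ (X a) y₀ := by
    intro a
    have h1 : DifferentiableAt ℂ (fun y => (r.logDeriv φ.symm y).inverse) y₀ :=
      (((isInvertible_logDeriv r (1 : G) hy₀).contDiffAt_map_inverse (n := ω)).comp y₀
        hω).differentiableAt (by simp)
    refine (h1.clm_apply (differentiableAt_const a)).congr_of_eventuallyEq ?_
    filter_upwards [hev] with y hy using hX' a y hy
  have hder : ∀ a u, r.logDeriv φ.symm y₀ (fderiv ℂ (X a) y₀ u)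
      = - fderiv ℂ (r.logDeriv φ.symm) y₀ u (X a y₀) := by
    intro a u
    have h1 : (fun y => r.logDeriv φ.symm y (X a y)) =ᶠ[𝓝 y₀] fun _ => a := by
      filter_upwards [hev] with y hy using hX a y hy
    have h2 := congrArg (fun f : E →L[ℂ] E => f u) h1.fderiv_eq
    rw [fderiv_clm_apply hωd (hXd a)] at h2
    simp only [_root_.add_apply, ContinuousLinearMap.comp_apply,
      ContinuousLinearMap.flip_apply, fderiv_const_apply, _root_.zero_apply] at h2
    exact eq_neg_of_add_eq_zero_left h2
  have h1 : ∀ u : E, r.logDeriv φ.symm y₀ u = u := fun u => by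
    rw [logDeriv_chart_symm_self, toOne_one]
  have hmc := r.maurerCartan (contMDiffAt_chart_symm (1 : G) hy₀) (X a y₀) (X b y₀)
  rw [← hφ, hX a y₀ hy₀, hX b y₀ hy₀] at hmc
  rw [hbr, ← h1 (VectorField.lieBracket ℂ (X a) (X b) y₀), VectorField.lieBracket, map_sub,
    hder, hder, ← neg_neg (r.bracket a b), ← hmc]
  abel

end LinearRealization

end LieBracket

/-! ### Left-invariant metrics and their homotheties -/

section LeftInvariantMetric

open Topology

variable {E : Type*} [NormedAddCommGroup E] [NormedSpace ℂ E]
  {G : Type*} [TopologicalSpace G] [ChartedSpace E G] [Group G]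
  {R : Type*} [NormedRing R] [NormedAlgebra ℂ R]
  {W : Type*} [NormedAddCommGroup W] [InnerProductSpace ℂ W]

namespace LinearRealization

variable (r : LinearRealization E G R)

/-- The bracket, transported to `W` by `L`. -/
def bracketBilin (L : E ≃L[ℂ] W) : W →ₗ[ℂ] W →ₗ[ℂ] W :=
  LinearMap.mk₂ ℂ (fun x y => L (r.bracket (L.symm x) (L.symm y)))
    (fun x x' y => by simp only [bracket, map_add, map_sub, add_mul, mul_add]; abel)
    (fun c x y => by simp [bracket, smul_sub])
    (fun x y y' => by simp only [bracket, map_add, map_sub, add_mul, mul_add]; abel)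
    (fun c x y => by simp [bracket, smul_sub])

lemma bracketBilin_apply (L : E ≃L[ℂ] W) (x y : W) :
    r.bracketBilin L x y = L (r.bracket (L.symm x) (L.symm y)) := rfl

variable [LieGroup 𝓘(ℂ, E) ω G]

lemma inChart_leftInvariant (L : E ≃L[ℂ] W) (p : G) {y : E}
    (hy : y ∈ (extChartAt 𝓘(ℂ, E) p).target) (u v : E) :
    inChart (fun (x : G) (u v : E) => inner ℂ (L (toOne (E := E) x v)) (L (toOne (E := E) x u)))
        p y u v
      = inner ℂ (L (r.logDeriv (extChartAt 𝓘(ℂ, E) p).symm y v))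
          (L (r.logDeriv (extChartAt 𝓘(ℂ, E) p).symm y u)) := by
  rw [logDeriv_chart_symm r p hy, logDeriv_chart_symm r p hy]
  rfl

/-- The left-invariant Hermitian metric that makes the linear map `L` from the Lie algebra to a
Hermitian space `W` an isometry at the identity. The inner product of `W` is conjugate linear in its
first argument, hence the order `v`, `u`. -/
def leftInvariantMetric (L : E ≃L[ℂ] W) : HermitianMetric E G where
  form x u v := inner ℂ (L (toOne (E := E) x v)) (L (toOne (E := E) x u))
  add_left x u v w := by
    have h : toOne (E := E) x (u + v : E) = toOne (E := E) x u + toOne (E := E) x v := map_add _ _ _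
    exact (congrArg (fun a => inner ℂ (L (toOne (E := E) x w)) (L a)) h).trans
      (by rw [map_add, inner_add_right])
  smul_left x c u w := by
    have h : toOne (E := E) x (c • u : E) = c • toOne (E := E) x u := map_smul _ _ _
    exact (congrArg (fun a => inner ℂ (L (toOne (E := E) x w)) (L a)) h).trans
      (by rw [map_smul, inner_smul_right])
  conj_symm x u v := inner_conj_symm _ _
  pos x u hu := by
    have h : L (toOne (E := E) x u) ≠ 0 := by
      intro h0
      exact hu ((map_eq_zero_iff _ ((toOneEquiv (E := E) x).trans L).injective).1 h0)
    change 0 < RCLike.re (inner ℂ (L (toOne (E := E) x u)) (L (toOne (E := E) x u)))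
    rw [← norm_sq_eq_re_inner]
    positivity
  smooth p u v := by
    have h : ContDiffOn ℂ ω (r.logDeriv (extChartAt 𝓘(ℂ, E) p).symm)
        (extChartAt 𝓘(ℂ, E) p).target := fun y hy =>
      (r.contDiffAt_logDeriv (contMDiffAt_chart_symm p hy)).contDiffWithinAt
    have h' : ∀ w : E, ContDiffOn ℝ ∞
        (fun y => L (r.logDeriv (extChartAt 𝓘(ℂ, E) p).symm y w))
        (extChartAt 𝓘(ℂ, E) p).target := fun w =>
      ((L.contDiff.comp_contDiffOn (h.clm_apply contDiffOn_const)).restrict_scalars ℝ).of_le le_top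
    exact ((h' v).inner ℂ (h' u)).congr fun y hy => inChart_leftInvariant r L p hy u v

lemma leftInvariantMetric_form (L : E ≃L[ℂ] W) (x : G) (u v : E) :
    (r.leftInvariantMetric L).form x u v
      = inner ℂ (L (toOne (E := E) x v)) (L (toOne (E := E) x u)) := rfl

lemma leftInvariantMetric_form_one (L : E ≃L[ℂ] W) (u v : E) :
    (r.leftInvariantMetric L).form 1 u v = inner ℂ (L v) (L u) := by
  rw [leftInvariantMetric_form, toOne_one, toOne_one]

lemma isLeftInvariant_leftInvariantMetric (L : E ≃L[ℂ] W) :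
    IsLeftInvariant (r.leftInvariantMetric L) := by
  intro a x u v
  have h : ∀ u : E, toOne (E := E) (a * x) (mderiv E E (fun z : G => a * z) x u)
    = toOne (E := E) x u := toOne_mul a x
  exact congrArg₂ (fun a b => inner ℂ (L a) (L b)) (h v) (h u)

/-- The value of `Θ` at the identity for the metric defined by `L`, in terms of an `L`-orthonormal
frame `e` of the Lie algebra: `(1/2) ∑ i j, g([e i, e j], v̄) g(u, [e i, e j]‾)`. -/
def thetaForm {ι : Type*} [Fintype ι] (L : E ≃L[ℂ] W) (e : ι → E) (u v : E) : ℂ :=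
  (1 / 2) * ∑ i, ∑ j, inner ℂ (L v) (L (r.bracket (e i) (e j)))
    * inner ℂ (L (r.bracket (e i) (e j))) (L u)

variable [FiniteDimensional ℂ E]

/-- `Θ` of the metric pulled back by a local parametrization `k` of the group and scaled by `s²`.
The scaling does not matter, as `Θ` is invariant under it; a general `s` serves homotheties. -/
lemma localTheta_eq_thetaForm {ι : Type*} [Fintype ι] (L : E ≃L[ℂ] W) (e : ι → E)
    (o : OrthonormalBasis ι ℂ W) (ho : ∀ i, o i = L (e i)) {h : E → E → E → ℂ} {y : E}
    {k : E → G} (hk : ContMDiffAt 𝓘(ℂ, E) 𝓘(ℂ, E) ω k y) {s : ℝ} (hs : s ≠ 0)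
    (hh : ∀ᶠ z in 𝓝 y, ∀ u v, h z u v
      = (s : ℂ) ^ 2 * inner ℂ (L (r.logDeriv k z v)) (L (r.logDeriv k z u)))
    (hb : Function.Bijective (r.logDeriv k y)) (u v : E) :
    localTheta h y u v = r.thetaForm L e (r.logDeriv k y u) (r.logDeriv k y v) := by
  have hsc : (s : ℂ) ≠ 0 := by exact_mod_cast hs
  let A : E → E →L[ℂ] W := fun z => ((s : ℂ) • (L : E →L[ℂ] W)) ∘L r.logDeriv k z
  have hA : ContDiffAt ℂ ω A y := contDiffAt_const.clm_comp (r.contDiffAt_logDeriv hk)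
  have hAz : ∀ z u, A z u = (s : ℂ) • L (r.logDeriv k z u) := fun _ _ => rfl
  have hh' : ∀ᶠ z in 𝓝 y, ∀ u v, h z u v = inner ℂ (A z v) (A z u) := by
    filter_upwards [hh] with z hz u v
    rw [hz, hAz, hAz, inner_smul_left, inner_smul_right, Complex.conj_ofReal]
    ring
  have hAb : Function.Bijective (A y) := by
    have : ⇑(A y) = (fun w => (s : ℂ) • w) ∘ L ∘ r.logDeriv k y := rfl
    rw [this]
    exact (MulAction.bijective₀ hsc).comp (L.bijective.comp hb)
  have hd : DifferentiableAt ℂ (r.logDeriv k) y :=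
    (r.contDiffAt_logDeriv hk).differentiableAt (by simp)
  have hfd : ∀ u v, fderiv ℂ A y u v = (s : ℂ) • L (fderiv ℂ (r.logDeriv k) y u v) := by
    intro u v
    have : fderiv ℂ A y = _ := ((hasFDerivAt_const ((s : ℂ) • (L : E →L[ℂ] W)) y).clm_comp
      hd.hasFDerivAt).fderiv
    rw [this]
    simp
  have hc : ∀ u v, fderiv ℂ A y u v - fderiv ℂ A y v u
      = (-(s : ℂ)⁻¹ • r.bracketBilin L) (A y u) (A y v) := by
    intro u v
    rw [hfd, hfd, ← smul_sub, ← map_sub, r.maurerCartan hk]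
    simp only [hAz, LinearMap.smul_apply, map_smul, bracketBilin_apply,
      ContinuousLinearEquiv.symm_apply_apply, map_neg, smul_smul, smul_neg]
    rw [← neg_smul]
    congr 1
    field_simp
  rw [localTheta_of_coframe (hA.of_le le_top) hh' hAb _ hc o, thetaForm]
  congr 1
  refine Finset.sum_congr rfl fun i _ => Finset.sum_congr rfl fun j _ => ?_
  simp only [ho, LinearMap.smul_apply, bracketBilin_apply,
    ContinuousLinearEquiv.symm_apply_apply, hAz, inner_smul_left, inner_smul_right,
    map_neg, map_inv₀, Complex.conj_ofReal]
  field_simp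

theorem Theta_leftInvariantMetric {ι : Type*} [Fintype ι] (L : E ≃L[ℂ] W) (e : ι → E)
    (o : OrthonormalBasis ι ℂ W) (ho : ∀ i, o i = L (e i)) (p : G) (u v : E) :
    Theta (r.leftInvariantMetric L) p u v
      = r.thetaForm L e (toOne (E := E) p u) (toOne (E := E) p v) := by
  have hp : extChartAt 𝓘(ℂ, E) p p ∈ (extChartAt 𝓘(ℂ, E) p).target := mem_extChartAt_target p
  have h1 : Theta (r.leftInvariantMetric L) p u v
    = localTheta (inChart (r.leftInvariantMetric L).form p) (extChartAt 𝓘(ℂ, E) p p)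
      (mderiv E E (extChartAt 𝓘(ℂ, E) p) p u) (mderiv E E (extChartAt 𝓘(ℂ, E) p) p v) := rfl
  rw [h1, mderiv_chart_self, mderiv_chart_self,
    r.localTheta_eq_thetaForm L e o ho (contMDiffAt_chart_symm p hp) one_ne_zero,
    logDeriv_chart_symm_self, logDeriv_chart_symm_self]
  · filter_upwards [(isOpen_extChartAt_target p).mem_nhds hp] with y hy u v
    rw [Complex.ofReal_one, one_pow, one_mul]
    exact inChart_leftInvariant r L p hy u v
  · obtain ⟨f, hf⟩ := r.isInvertible_logDeriv p hp
    rw [← hf]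
    exact f.bijective

/-- A homothety of left-invariant metrics need not fix the identity or be a homomorphism, but its
derivative, translated to the identity on both sides, is a linear map that scales the metrics and
preserves `Θ`. -/
theorem exists_linearEquiv_of_homothetic {ι ι' W' : Type*} [Fintype ι] [Fintype ι']
    [NormedAddCommGroup W'] [InnerProductSpace ℂ W']
    (L : E ≃L[ℂ] W) (e : ι → E) (o : OrthonormalBasis ι ℂ W) (ho : ∀ i, o i = L (e i))
    (L' : E ≃L[ℂ] W') (e' : ι' → E) (o' : OrthonormalBasis ι' ℂ W') (ho' : ∀ i, o' i = L' (e' i))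
    (h : Homothetic (r.leftInvariantMetric L) (r.leftInvariantMetric L')) :
    ∃ (T : E ≃ₗ[ℂ] E) (c : ℝ), 0 < c ∧
      (∀ u v, inner ℂ (L' (T v)) (L' (T u)) = c * inner ℂ (L v) (L u)) ∧
      ∀ u v, r.thetaForm L' e' (T u) (T v) = r.thetaForm L e u v := by
  obtain ⟨f, c, hc, hf⟩ := h
  set ψ := (extChartAt 𝓘(ℂ, E) (1 : G)).symm with hψ
  set y₀ := extChartAt 𝓘(ℂ, E) (1 : G) 1
  have hy₀ : y₀ ∈ (extChartAt 𝓘(ℂ, E) (1 : G)).target := mem_extChartAt_target 1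
  have hk : ∀ y ∈ (extChartAt 𝓘(ℂ, E) (1 : G)).target,
      ContMDiffAt 𝓘(ℂ, E) 𝓘(ℂ, E) ω (fun z => f (ψ z)) y := fun y hy =>
    (f.contMDiff (ψ y)).comp y (contMDiffAt_chart_symm 1 hy)
  have hf' : ∀ (x : G) (u v : E),
      inner ℂ (L' (toOne (E := E) (f x) (mderiv E E f x v)))
        (L' (toOne (E := E) (f x) (mderiv E E f x u)))
      = c * inner ℂ (L (toOne (E := E) x v)) (L (toOne (E := E) x u)) := hf
  have hmet : ∀ y ∈ (extChartAt 𝓘(ℂ, E) (1 : G)).target, ∀ u v,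
      inner ℂ (L' (r.logDeriv (fun z => f (ψ z)) y v)) (L' (r.logDeriv (fun z => f (ψ z)) y u))
      = c * inner ℂ (L (r.logDeriv ψ y v)) (L (r.logDeriv ψ y u)) := by
    intro y hy u v
    have hd := contMDiffAt_chart_symm (1 : G) hy
    rw [← r.toOne_mderiv ((hk y hy).mdifferentiableAt (by simp)),
      ← r.toOne_mderiv ((hk y hy).mdifferentiableAt (by simp)),
      mderiv_comp ((f.contMDiff (ψ y)).mdifferentiableAt (by simp))
        (hd.mdifferentiableAt (by simp)),
      mderiv_comp ((f.contMDiff (ψ y)).mdifferentiableAt (by simp))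
        (hd.mdifferentiableAt (by simp)),
      hf', r.toOne_mderiv (hd.mdifferentiableAt (by simp)),
      r.toOne_mderiv (hd.mdifferentiableAt (by simp))]
  have hid : ∀ u : E, r.logDeriv ψ y₀ u = u := fun u => by
    rw [logDeriv_chart_symm_self, toOne_one]
  have hmet₀ := hmet y₀ hy₀
  simp only [hid] at hmet₀
  have hinj : Function.Injective (r.logDeriv (fun z => f (ψ z)) y₀) := by
    rw [injective_iff_map_eq_zero]
    intro u hu
    have := hmet₀ u u
    rw [hu, map_zero, inner_zero_left] at this
    have hc' : (c : ℂ) ≠ 0 := by exact_mod_cast hc.ne'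
    simpa [hc'] using this.symm
  have hbij : Function.Bijective (r.logDeriv (fun z => f (ψ z)) y₀) :=
    ⟨hinj, (LinearMap.injective_iff_surjective
      (f := (r.logDeriv (fun z => f (ψ z)) y₀ : E →ₗ[ℂ] E))).1 hinj⟩
  have hnhds := (isOpen_extChartAt_target (I := 𝓘(ℂ, E)) (1 : G)).mem_nhds hy₀
  refine ⟨LinearEquiv.ofBijective (r.logDeriv (fun z => f (ψ z)) y₀ : E →ₗ[ℂ] E) hbij, c, hc,
    hmet₀, fun u v => ?_⟩
  let h : E → E → E → ℂ := fun y u v => inner ℂ (L (r.logDeriv ψ y v)) (L (r.logDeriv ψ y u))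
  have h1 := r.localTheta_eq_thetaForm L e o ho (h := h) (contMDiffAt_chart_symm 1 hy₀)
    one_ne_zero (by
      filter_upwards [hnhds] with y hy u v
      simp [h, hψ]) (by
      refine ⟨fun a b hab => ?_, fun b => ⟨b, hid b⟩⟩
      rwa [← hψ, hid, hid] at hab) u v
  rw [← hψ, hid, hid] at h1
  have hsc : ((√c⁻¹ : ℝ) : ℂ) ^ 2 = (c : ℂ)⁻¹ := by
    rw [← Complex.ofReal_pow, Real.sq_sqrt (inv_nonneg.2 hc.le), Complex.ofReal_inv]
  have h2 := r.localTheta_eq_thetaForm L' e' o' ho' (h := h) (hk y₀ hy₀)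
    (s := √c⁻¹) (Real.sqrt_pos.2 (inv_pos.2 hc)).ne' (by
      filter_upwards [hnhds] with y hy u v
      have hc' : (c : ℂ) ≠ 0 := by exact_mod_cast hc.ne'
      rw [hsc, hmet y hy, inv_mul_cancel_left₀ hc']) hbij u v
  exact h2.symm.trans h1

end LinearRealization

end LeftInvariantMetric

/-! ### Simple connectedness of punctured spaces -/

section SimplyConnected

open Topology unitInterval

variable {V : Type*} [NormedAddCommGroup V] [NormedSpace ℝ V]

lemma exists_contDiff_dist_lt {f : ℝ → V} (hf : Continuous f) {ε : ℝ} (hε : 0 < ε) :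
    ∃ g : ℝ → V, ContDiff ℝ 1 g ∧ ∀ t, dist (g t) (f t) < ε := by
  obtain ⟨g, hg⟩ := exists_contMDiffMap_forall_mem_convex_of_local_const (n := 1) 𝓘(ℝ, ℝ)
    (t := fun t => Metric.ball (f t) ε) (fun t => convex_ball _ _) (fun t => ⟨f t, by
      filter_upwards [hf.continuousAt.eventually (Metric.ball_mem_nhds (f t) hε)] with s hs
      rw [Metric.mem_ball, dist_comm]
      exact hs⟩)
  exact ⟨g, g.contMDiff.contDiff, hg⟩

/-- The smooth approximation of the previous lemma is corrected by an affine function to have the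
given endpoints. -/
lemma exists_contDiff_loop_dist_lt {x : V} (p : Path x x) {ε : ℝ} (hε : 0 < ε) :
    ∃ g : ℝ → V, ContDiff ℝ 1 g ∧ g 0 = x ∧ g 1 = x ∧ ∀ t : I, dist (g t) (p t) < ε := by
  obtain ⟨g, hg, hgp⟩ := exists_contDiff_dist_lt p.continuous_extend (half_pos hε)
  refine ⟨fun t => g t + ((1 - t) • (x - g 0) + t • (x - g 1)), ?_, by simp, by simp, ?_⟩
  · fun_prop
  · intro t
    have h0 : ‖x - g 0‖ < ε / 2 := by simpa [dist_comm, dist_eq_norm] using hgp 0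
    have h1 : ‖x - g 1‖ < ε / 2 := by simpa [dist_comm, dist_eq_norm] using hgp 1
    have ht : ‖g t - p t‖ < ε / 2 := by simpa [dist_eq_norm] using hgp t
    have hc := (convex_ball (0 : V) (ε / 2)) (mem_ball_zero_iff.2 h0) (mem_ball_zero_iff.2 h1)
      (sub_nonneg.2 t.2.2) t.2.1 (by ring)
    rw [mem_ball_zero_iff] at hc
    rw [dist_eq_norm, add_sub_right_comm]
    linarith [norm_add_le (g t - p t) ((1 - (t : ℝ)) • (x - g 0) + (t : ℝ) • (x - g 1))]

/-- A loop that avoids `0` is homotopic to a smooth one, the cone over which has measure zero when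
the dimension is at least `3`. For `w` outside of this cone, the loop lies in the complement of the
ray opposite to `w`, which is star-shaped around `w`. -/
theorem isSimplyConnected_compl_zero [FiniteDimensional ℝ V] (h : 2 < Module.finrank ℝ V) :
    IsSimplyConnected ({0}ᶜ : Set V) := by
  rw [isSimplyConnected_iff_exists_homotopy_refl_forall_mem]
  refine ⟨isPathConnected_compl_singleton_of_one_lt_rank
    (by rw [← Module.finrank_eq_rank]; exact_mod_cast (by omega : 1 < _)) 0, fun x p hp => ?_⟩
  have hx : x ≠ 0 := by simpa using hp 0
  obtain ⟨ε, hε, hpε⟩ : ∃ ε > 0, ∀ t, ε ≤ ‖p t‖ := by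
    obtain ⟨t, -, ht⟩ := isCompact_univ.exists_isMinOn (Set.univ_nonempty (α := I))
      (p.continuous.norm.continuousOn)
    exact ⟨‖p t‖, norm_pos_iff.2 (by simpa using hp t), fun s => ht (Set.mem_univ s)⟩
  obtain ⟨g, hg, hg0, hg1, hgp⟩ := exists_contDiff_loop_dist_lt p hε
  let q : Path x x :=
    { toFun := fun t => g t
      continuous_toFun := hg.continuous.comp continuous_subtype_val
      source' := by simpa using hg0
      target' := by simpa using hg1 }
  have hqp : ∀ t, ‖q t - p t‖ < ε := fun t => by
    have := hgp t
    rwa [dist_eq_norm] at this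
  -- the straight line from `p t` to `q t` stays at distance less than `ε` from `p t`
  let F₁ : p.Homotopy q :=
    { ContinuousMap.Homotopy.affine p.toContinuousMap q.toContinuousMap with
      prop' := by
        rintro t s (rfl | rfl) <;> simp }
  have hF₁ : ∀ z, F₁ z ∈ ({0}ᶜ : Set V) := by
    rintro ⟨t, s⟩ h0
    have h1 : F₁ (t, s) = p s + (t : ℝ) • (q s - p s) := by
      change Path.segment (p s) (q s) t = _
      simp [AffineMap.lineMap_apply, add_comm]
    rw [Set.mem_singleton_iff, h1] at h0
    have h2 : ‖p s‖ = (t : ℝ) * ‖q s - p s‖ := by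
      have := congrArg norm (eq_neg_of_add_eq_zero_left h0)
      rwa [norm_neg, norm_smul, Real.norm_of_nonneg t.2.1] at this
    have h3 := hpε s
    have h4 : (t : ℝ) * ‖q s - p s‖ ≤ 1 * ‖q s - p s‖ :=
      mul_le_mul_of_nonneg_right t.2.2 (norm_nonneg _)
    linarith [hqp s]
  have hq0 : ∀ s, q s ≠ 0 := fun s => by
    have := hF₁ (1, s)
    rw [F₁.apply_one] at this
    simpa using this
  -- a direction that the cone over the smooth loop misses
  obtain ⟨w, hw⟩ : ∃ w, w ∉ Set.range fun z : ℝ × ℝ => z.1 • g z.2 := by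
    have hd : Dense (Set.range fun z : ℝ × ℝ => z.1 • g z.2)ᶜ :=
      ContDiff.dense_compl_range_of_finrank_lt_finrank (by fun_prop) (by simpa using h)
    exact hd.nonempty
  let U : Set V := {z | ∀ t : ℝ, 0 ≤ t → z ≠ -(t • w)}
  have hwU : w ∈ U := fun t ht hwt => by
    have h1 : (1 + t) • w = 0 := by
      rw [add_smul, one_smul]
      nth_rw 1 [hwt]
      simp
    have h2 : w = 0 := (smul_eq_zero.1 h1).resolve_left (by positivity)
    exact hw ⟨(0, 0), by simp [h2]⟩
  have hstar : StarConvex ℝ w U := by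
    intro z hz a b ha hb hab t ht hzt
    rcases hb.eq_or_lt with rfl | hb
    · rw [add_zero] at hab
      rw [hab, one_smul, zero_smul, add_zero] at hzt
      exact hwU t ht hzt
    · refine hz ((t + a) / b) (by positivity) ?_
      have h1 : b • z = -((t + a) • w) := by
        rw [add_smul, neg_add, ← hzt]
        abel
      rw [div_eq_inv_mul, mul_smul, ← smul_neg, ← h1, smul_smul, inv_mul_cancel₀ hb.ne', one_smul]
  have hqU : ∀ s, q s ∈ U := fun s t ht hst => by
    rcases ht.eq_or_lt with rfl | ht
    · exact hq0 s (by simpa using hst)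
    · refine hw ⟨(-t⁻¹, s), ?_⟩
      change -t⁻¹ • q s = w
      rw [hst, smul_neg, neg_smul, neg_neg, smul_smul, inv_mul_cancel₀ ht.ne', one_smul]
  have hU0 : U ⊆ {0}ᶜ := fun z hz h0 => hz 0 le_rfl (by simpa using h0)
  have hUsc : IsSimplyConnected U := by
    have := hstar.contractibleSpace ⟨w, hwU⟩
    exact (inferInstance : SimplyConnectedSpace U)
  obtain ⟨F₂, hF₂⟩ := (isSimplyConnected_iff_exists_homotopy_refl_forall_mem.1 hUsc).2 x q hqU
  refine ⟨F₁.trans F₂, fun z => ?_⟩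
  rw [Path.Homotopy.trans_apply]
  split_ifs
  · exact hF₁ _
  · exact hU0 (hF₂ _)

end SimplyConnected

/-! ### Simple connectedness of `SL(2, ℂ)` -/

section SimplyConnectedSL2

lemma simplyConnectedSpace_prod {X Y : Type*} [TopologicalSpace X] [TopologicalSpace Y]
    [SimplyConnectedSpace X] [SimplyConnectedSpace Y] : SimplyConnectedSpace (X × Y) := by
  rw [simply_connected_iff_paths_homotopic]
  refine ⟨inferInstance, fun x y => ⟨fun p q => ?_⟩⟩
  rw [← Path.Homotopic.prod_projLeft_projRight p, ← Path.Homotopic.prod_projLeft_projRight q,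
    Subsingleton.elim (Path.Homotopic.projLeft p) (Path.Homotopic.projLeft q),
    Subsingleton.elim (Path.Homotopic.projRight p) (Path.Homotopic.projRight q)]

/-- The group `SL(2, ℂ)`. -/
abbrev SL2 : Type := Matrix.SpecialLinearGroup (Fin 2) ℂ

lemma normSq_add_ne_zero {v : ℂ × ℂ} (hv : v ≠ 0) :
    v.1 * conj v.1 + v.2 * conj v.2 ≠ 0 := by
  rw [Complex.mul_conj, Complex.mul_conj, ← Complex.ofReal_add]
  intro h
  have h' := Complex.ofReal_eq_zero.1 h
  have h1 := Complex.normSq_nonneg v.1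
  have h2 := Complex.normSq_nonneg v.2
  exact hv (Prod.ext (Complex.normSq_eq_zero.1 (by linarith))
    (Complex.normSq_eq_zero.1 (by linarith)))

lemma SL2.det_eq (m : SL2) : m 0 0 * m 1 1 - m 0 1 * m 1 0 = 1 := by
  rw [← Matrix.det_fin_two]; exact m.2

lemma SL2.firstColumn_ne_zero (m : SL2) : (m 0 0, m 1 0) ≠ (0 : ℂ × ℂ) := fun h => by
  have h' := Prod.mk_eq_zero.1 h
  have := m.det_eq
  rw [h'.1, h'.2] at this
  simp at this

/-- A matrix in `SL(2, ℂ)` is determined by its first column `p ≠ 0` and the component along `p` of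
its second column, which is free. -/
def firstColumnHomeomorph : SL2 ≃ₜ ({0}ᶜ : Set (ℂ × ℂ)) × ℂ where
  toFun m := (⟨(m 0 0, m 1 0), m.firstColumn_ne_zero⟩,
    (m 0 1 * conj (m 0 0) + m 1 1 * conj (m 1 0))
      / (m 0 0 * conj (m 0 0) + m 1 0 * conj (m 1 0)))
  invFun z := ⟨!![z.1.1.1, z.2 * z.1.1.1
        - conj z.1.1.2 / (z.1.1.1 * conj z.1.1.1 + z.1.1.2 * conj z.1.1.2);
      z.1.1.2, z.2 * z.1.1.2
        + conj z.1.1.1 / (z.1.1.1 * conj z.1.1.1 + z.1.1.2 * conj z.1.1.2)], by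
    have := normSq_add_ne_zero z.1.2
    rw [Matrix.det_fin_two]
    simp
    field_simp
    ring⟩
  left_inv m := by
    have h : m 0 0 * conj (m 0 0) + m 1 0 * conj (m 1 0) ≠ 0 :=
      normSq_add_ne_zero (v := (m 0 0, m 1 0)) m.firstColumn_ne_zero
    have hd := m.det_eq
    obtain ⟨N, hN⟩ : ∃ N, N = m 0 0 * conj (m 0 0) + m 1 0 * conj (m 1 0) := ⟨_, rfl⟩
    rw [← hN] at h
    ext i j
    fin_cases i <;> fin_cases j
    · simp
    · simp [← hN]
      field_simp
      rw [hN]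
      linear_combination conj (m 1 0) * hd
    · simp
    · simp [← hN]
      field_simp
      rw [hN]
      linear_combination (-conj (m 0 0)) * hd
  right_inv z := by
    have h := normSq_add_ne_zero z.1.2
    obtain ⟨N, hN⟩ : ∃ N, N = z.1.1.1 * conj z.1.1.1 + z.1.1.2 * conj z.1.1.2 := ⟨_, rfl⟩
    rw [← hN] at h
    refine Prod.ext (Subtype.ext ?_) ?_
    · simp
    · simp [← hN]
      field_simp
      rw [hN]
      ring
  continuous_toFun := by
    have hc : ∀ i j, Continuous fun m : SL2 => m i j := fun i j => by fun_prop
    have hs : ∀ i j, Continuous fun m : SL2 => conj (m i j) := fun i j =>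
      Complex.continuous_conj.comp (hc i j)
    refine Continuous.prodMk (Continuous.subtype_mk ((hc 0 0).prodMk (hc 1 0)) _)
      (Continuous.div₀ (((hc 0 1).mul (hs 0 0)).add ((hc 1 1).mul (hs 1 0)))
        (((hc 0 0).mul (hs 0 0)).add ((hc 1 0).mul (hs 1 0))) fun m => ?_)
    exact normSq_add_ne_zero (v := (m 0 0, m 1 0)) m.firstColumn_ne_zero
  continuous_invFun := by
    have h1 : Continuous fun z : ({0}ᶜ : Set (ℂ × ℂ)) × ℂ => z.1.1.1 := by fun_prop
    have h2 : Continuous fun z : ({0}ᶜ : Set (ℂ × ℂ)) × ℂ => z.1.1.2 := by fun_prop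
    have h3 := Complex.continuous_conj.comp h1
    have h4 := Complex.continuous_conj.comp h2
    have h5 := (h1.mul h3).add (h2.mul h4)
    refine Continuous.subtype_mk (continuous_matrix fun i j => ?_) _
    fin_cases i <;> fin_cases j
    · exact h1
    · exact (continuous_snd.mul h1).sub (h4.div₀ h5 fun z => normSq_add_ne_zero z.1.2)
    · exact h2
    · exact (continuous_snd.mul h2).add (h3.div₀ h5 fun z => normSq_add_ne_zero z.1.2)

instance : SimplyConnectedSpace SL2 := by
  have h : IsSimplyConnected ({0}ᶜ : Set (ℂ × ℂ)) :=
    isSimplyConnected_compl_zero (by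
      rw [Module.finrank_prod, Complex.finrank_real_complex]; norm_num)
  have := h.simplyConnectedSpace
  have : SimplyConnectedSpace (({0}ᶜ : Set (ℂ × ℂ)) × ℂ) := simplyConnectedSpace_prod
  exact firstColumnHomeomorph.toHomotopyEquiv.simplyConnectedSpace

end SimplyConnectedSL2

/-! ### The complex Lie group `SL(2, ℂ)` -/

section SL2Manifold

open Topology

/-- The model space of `SL(2, ℂ)`. -/
abbrev E3 : Type := EuclideanSpace ℂ (Fin 3)

/-- The 2 × 2 matrices, as operators in order to have a submultiplicative norm. -/
abbrev M2 : Type := (Fin 2 → ℂ) →L[ℂ] (Fin 2 → ℂ)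

/-- The operator of a matrix. -/
def M2.ofMatrix : Matrix (Fin 2) (Fin 2) ℂ ≃L[ℂ] M2 :=
  LinearEquiv.toContinuousLinearEquiv (Matrix.toLin' ≪≫ₗ LinearMap.toContinuousLinearMap)

/-- The matrix entries of an operator. -/
def entry (i j : Fin 2) : M2 →L[ℂ] ℂ :=
  ContinuousLinearMap.proj (R := ℂ) i ∘L ContinuousLinearMap.apply ℂ (Fin 2 → ℂ) (Pi.single j 1)

lemma entry_def (i j : Fin 2) (m : M2) : entry i j m = m (Pi.single j 1) i := rfl

lemma M2.ofMatrix_apply (A : Matrix (Fin 2) (Fin 2) ℂ) (v : Fin 2 → ℂ) :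
    M2.ofMatrix A v = Matrix.mulVec A v := rfl

@[simp] lemma entry_ofMatrix (i j : Fin 2) (A : Matrix (Fin 2) (Fin 2) ℂ) :
    entry i j (M2.ofMatrix A) = A i j := by
  rw [entry_def, M2.ofMatrix_apply, Matrix.mulVec_single_one]
  rfl

lemma M2.ext {m m' : M2} (h : ∀ i j, entry i j m = entry i j m') : m = m' := by
  have h' : (m : (Fin 2 → ℂ) →ₗ[ℂ] (Fin 2 → ℂ)) = m' :=
    LinearMap.pi_ext' fun j => LinearMap.ext_ring (funext fun i => h i j)
  exact ContinuousLinearMap.coe_injective h'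

@[simp] lemma entry_mul (i j : Fin 2) (m m' : M2) :
    entry i j (m * m') = entry i 0 m * entry 0 j m' + entry i 1 m * entry 1 j m' := by
  have h : ∀ v : Fin 2 → ℂ, m v i = v 0 * entry i 0 m + v 1 * entry i 1 m := by
    intro v
    have hv : v = v 0 • Pi.single 0 1 + v 1 • Pi.single 1 1 := by
      ext k
      fin_cases k <;> simp
    conv_lhs => rw [hv, map_add, map_smul, map_smul]
    rfl
  change m (m' (Pi.single j 1)) i = _
  rw [h]
  simp only [entry_def]
  ring

/-- The operator with matrix `!![a, b; c, d]`. -/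
def matrixOf (a b c d : ℂ) : M2 := M2.ofMatrix !![a, b; c, d]

@[simp] lemma entry_matrixOf (a b c d : ℂ) : entry 0 0 (matrixOf a b c d) = a ∧
    entry 0 1 (matrixOf a b c d) = b ∧ entry 1 0 (matrixOf a b c d) = c ∧
    entry 1 1 (matrixOf a b c d) = d := by
  simp [matrixOf]

lemma matrixOf_eq (a b c d : ℂ) : matrixOf a b c d =
    a • matrixOf 1 0 0 0 + b • matrixOf 0 1 0 0 + c • matrixOf 0 0 1 0 + d • matrixOf 0 0 0 1 := by
  refine M2.ext fun i j => ?_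
  fin_cases i <;> fin_cases j <;> simp

/-- The standard representation of `SL(2, ℂ)`. -/
def SL2.toM2 : SL2 →* M2 where
  toFun m := M2.ofMatrix m
  map_one' := M2.ext fun i j => by
    rw [entry_ofMatrix, Matrix.SpecialLinearGroup.coe_one, Matrix.one_apply]
    exact (Pi.single_apply _ _ _).symm
  map_mul' a b := M2.ext fun i j => by
    rw [entry_ofMatrix, Matrix.SpecialLinearGroup.coe_mul, Matrix.mul_apply, Fin.sum_univ_two]
    simp

@[simp] lemma entry_toM2 (i j : Fin 2) (m : SL2) : entry i j m.toM2 = m i j :=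
  entry_ofMatrix i j m

lemma isInducing_toM2 : IsInducing SL2.toM2 :=
  M2.ofMatrix.toHomeomorph.isInducing.comp (IsInducing.subtypeVal : IsInducing
    (Subtype.val : {A : Matrix (Fin 2) (Fin 2) ℂ // A.det = 1} → Matrix (Fin 2) (Fin 2) ℂ))

/-- An operator of determinant one, as an element of `SL(2, ℂ)`. -/
def SL2.ofM2 (m : M2) (h : entry 0 0 m * entry 1 1 m - entry 0 1 m * entry 1 0 m = 1) : SL2 :=
  ⟨Matrix.of fun i j => entry i j m, (Matrix.det_fin_two _).trans h⟩

lemma SL2.toM2_ofM2 (m : M2) (h : entry 0 0 m * entry 1 1 m - entry 0 1 m * entry 1 0 m = 1) :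
    (SL2.ofM2 m h).toM2 = m :=
  M2.ext fun i j => entry_toM2 i j _

lemma SL2.toM2_injective : Function.Injective SL2.toM2 := fun _ _ h =>
  Subtype.ext (M2.ofMatrix.injective h)

/-- A vector of three functionals. -/
def pauliCoord (p q r : M2 →L[ℂ] ℂ) : M2 →L[ℂ] E3 :=
  ((EuclideanSpace.equiv (Fin 3) ℂ).symm : (Fin 3 → ℂ) →L[ℂ] E3) ∘L
    ContinuousLinearMap.pi ![p, q, r]

/-- The coordinates on `𝔰𝔩(2, ℂ)` with respect to the basis `-i σ_k / 2`, in which the commutator is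
the cross product. The diagonal entries enter symmetrically. -/
def sl2Coord : M2 →L[ℂ] E3 :=
  pauliCoord (Complex.I • (entry 0 1 + entry 1 0)) (entry 1 0 - entry 0 1)
    (Complex.I • (entry 0 0 - entry 1 1))

/-- The coordinates that are used for charts of the group. They agree with `sl2Coord` on traceless
matrices, but use only the first of the diagonal entries, so that they are injective on matrices of
determinant one with nonzero upper left entry. -/
def chartCoord : M2 →L[ℂ] E3 :=
  pauliCoord (Complex.I • (entry 0 1 + entry 1 0)) (entry 1 0 - entry 0 1)
    ((2 * Complex.I) • entry 0 0)

lemma sl2Coord_apply (m : M2) :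
    sl2Coord m = !₂[Complex.I * (entry 0 1 m + entry 1 0 m), entry 1 0 m - entry 0 1 m,
      Complex.I * (entry 0 0 m - entry 1 1 m)] := by
  ext i; fin_cases i <;> rfl

lemma chartCoord_apply (m : M2) :
    chartCoord m = !₂[Complex.I * (entry 0 1 m + entry 1 0 m), entry 1 0 m - entry 0 1 m,
      (2 * Complex.I) * entry 0 0 m] := by
  ext i; fin_cases i <;> rfl

lemma contDiffOn_matrixOf {F : Type*} [NormedAddCommGroup F] [NormedSpace ℂ F]
    {a b c d : F → ℂ} {s : Set F} (ha : ContDiffOn ℂ ω a s) (hb : ContDiffOn ℂ ω b s)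
    (hc : ContDiffOn ℂ ω c s) (hd : ContDiffOn ℂ ω d s) :
    ContDiffOn ℂ ω (fun x => matrixOf (a x) (b x) (c x) (d x)) s := by
  have h : (fun x => matrixOf (a x) (b x) (c x) (d x)) = fun x =>
      a x • matrixOf 1 0 0 0 + b x • matrixOf 0 1 0 0 + c x • matrixOf 0 0 1 0
        + d x • matrixOf 0 0 0 1 := funext fun x => matrixOf_eq _ _ _ _
  rw [h]
  exact (((ha.smul contDiffOn_const).add (hb.smul contDiffOn_const)).add
    (hc.smul contDiffOn_const)).add (hd.smul contDiffOn_const)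

/-- The upper left entry of the matrix with coordinates `x`. -/
def entryA (x : E3) : ℂ := -(Complex.I / 2) * x 2
/-- The upper right entry of the matrix with coordinates `x`. -/
def entryB (x : E3) : ℂ := (-Complex.I * x 0 - x 1) / 2
/-- The lower left entry of the matrix with coordinates `x`. -/
def entryC (x : E3) : ℂ := (-Complex.I * x 0 + x 1) / 2

/-- The matrix of determinant one with coordinates `x`, for `x 2 ≠ 0`. -/
def chartInv (x : E3) : M2 :=
  matrixOf (entryA x) (entryB x) (entryC x) ((1 + entryB x * entryC x) / entryA x)

lemma contDiff_coord (i : Fin 3) : ContDiff ℂ ω fun x : E3 => x i :=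
  (EuclideanSpace.proj i : E3 →L[ℂ] ℂ).contDiff

lemma contDiff_entryA : ContDiff ℂ ω entryA := contDiff_const.mul (contDiff_coord 2)
lemma contDiff_entryB : ContDiff ℂ ω entryB :=
  ((contDiff_const.mul (contDiff_coord 0)).sub (contDiff_coord 1)).div_const 2
lemma contDiff_entryC : ContDiff ℂ ω entryC :=
  ((contDiff_const.mul (contDiff_coord 0)).add (contDiff_coord 1)).div_const 2

lemma entryA_ne_zero {x : E3} (hx : x 2 ≠ 0) : entryA x ≠ 0 := by simp [entryA, hx]

lemma contDiffOn_chartInv : ContDiffOn ℂ ω chartInv {x | x 2 ≠ 0} := by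
  refine contDiffOn_matrixOf contDiff_entryA.contDiffOn contDiff_entryB.contDiffOn
    contDiff_entryC.contDiffOn (ContDiffOn.div ?_ contDiff_entryA.contDiffOn fun x hx =>
      entryA_ne_zero hx)
  exact (contDiff_const.add (contDiff_entryB.mul contDiff_entryC)).contDiffOn

open Classical in
/-- The element of `SL(2, ℂ)` with coordinates `x`, with the junk value `1` for `x 2 = 0`. -/
def chartInvSL2 (x : E3) : SL2 :=
  if h : x 2 ≠ 0 then SL2.ofM2 (chartInv x) (by
    have h := entryA_ne_zero h
    simp only [chartInv, entry_matrixOf]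
    field_simp
    ring) else 1

lemma toM2_chartInvSL2 {x : E3} (hx : x 2 ≠ 0) : (chartInvSL2 x).toM2 = chartInv x := by
  rw [chartInvSL2, dif_pos hx, SL2.toM2_ofM2]

lemma chartInv_chartCoord {m : SL2} (hm : m 0 0 ≠ 0) : chartInv (chartCoord m.toM2) = m.toM2 := by
  have hA : entryA (chartCoord m.toM2) = m 0 0 := by
    simp [entryA, chartCoord_apply]
    linear_combination (-m 0 0) * Complex.I_mul_I
  have hB : entryB (chartCoord m.toM2) = m 0 1 := by
    simp [entryB, chartCoord_apply]
    linear_combination (-(m 0 1 + m 1 0) / 2) * Complex.I_mul_I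
  have hC : entryC (chartCoord m.toM2) = m 1 0 := by
    simp [entryC, chartCoord_apply]
    linear_combination (-(m 0 1 + m 1 0) / 2) * Complex.I_mul_I
  rw [chartInv, hA, hB, hC]
  refine M2.ext fun i j => ?_
  fin_cases i <;> fin_cases j <;> simp
  · change (1 + m 0 1 * m 1 0) / m 0 0 = m 1 1
    field_simp
    linear_combination -m.det_eq

lemma chartCoord_chartInv (x : E3) : chartCoord (chartInv x) = x := by
  rw [chartCoord_apply]
  ext i
  fin_cases i
  · simp [chartInv, entryB, entryC]
    linear_combination (-x 0) * Complex.I_mul_I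
  · simp [chartInv, entryB, entryC]
    ring
  · simp [chartInv, entryA]
    linear_combination (-x 2) * Complex.I_mul_I

/-- The chart around the identity, defined where the upper left entry is nonzero. -/
def chartOne : OpenPartialHomeomorph SL2 E3 where
  toFun m := chartCoord m.toM2
  invFun := chartInvSL2
  source := {m | entry 0 0 m.toM2 ≠ 0}
  target := {x | x 2 ≠ 0}
  map_source' m hm := by
    have : m 0 0 ≠ 0 := by simpa using hm
    simp [chartCoord_apply, this]
  map_target' x hx := by
    have hx' : x 2 ≠ 0 := hx
    change entry 0 0 (chartInvSL2 x).toM2 ≠ 0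
    rw [toM2_chartInvSL2 hx', chartInv, (entry_matrixOf _ _ _ _).1]
    exact entryA_ne_zero hx'
  left_inv' m hm := by
    have hm' : m 0 0 ≠ 0 := by simpa using hm
    have h : (chartCoord m.toM2) 2 ≠ 0 := by simp [chartCoord_apply, hm']
    exact SL2.toM2_injective (by rw [toM2_chartInvSL2 h, chartInv_chartCoord hm'])
  right_inv' x hx := by rw [toM2_chartInvSL2 hx, chartCoord_chartInv]
  open_source := isOpen_ne.preimage ((entry 0 0).continuous.comp isInducing_toM2.continuous)
  open_target := isOpen_ne.preimage (contDiff_coord 2).continuous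
  continuousOn_toFun := (chartCoord.continuous.comp isInducing_toM2.continuous).continuousOn
  continuousOn_invFun := isInducing_toM2.continuousOn_iff.2
    (contDiffOn_chartInv.continuousOn.congr fun _ hx => toM2_chartInvSL2 hx)

/-- The chart around `g`, obtained from the chart around the identity by left translation. -/
def translatedChart (g : SL2) : OpenPartialHomeomorph SL2 E3 :=
  (Homeomorph.mulLeft g⁻¹).transOpenPartialHomeomorph chartOne

instance : ChartedSpace E3 SL2 where
  atlas := Set.range translatedChart
  chartAt := translatedChart
  mem_chart_source g := by
    change entry 0 0 (g⁻¹ * g : SL2).toM2 ≠ 0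
    rw [inv_mul_cancel, entry_toM2]
    simp
  chart_mem_atlas g := ⟨g, rfl⟩

lemma translatedChart_apply (g m : SL2) :
    translatedChart g m = chartCoord (SL2.toM2 g⁻¹ * SL2.toM2 m) := by
  rw [← map_mul]
  rfl

lemma toM2_translatedChart_symm (g : SL2) {x : E3} (hx : x ∈ (translatedChart g).target) :
    SL2.toM2 ((translatedChart g).symm x) = g.toM2 * chartInv x := by
  have : (translatedChart g).symm x = g * chartInvSL2 x := by
    change (g⁻¹)⁻¹ * chartInvSL2 x = _
    rw [inv_inv]
  rw [this, map_mul, toM2_chartInvSL2 hx]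

lemma contDiffOn_translatedChart_symm (g : SL2) :
    ContDiffOn ℂ ω (fun x => SL2.toM2 ((translatedChart g).symm x)) (translatedChart g).target :=
  (contDiffOn_const.mul contDiffOn_chartInv).congr fun _ hx => toM2_translatedChart_symm g hx

instance : IsManifold 𝓘(ℂ, E3) ω SL2 := by
  refine isManifold_of_contDiffOn _ _ _ ?_
  rintro _ _ ⟨g, rfl⟩ ⟨h, rfl⟩
  have h1 : ContDiffOn ℂ ω (fun x => chartCoord (SL2.toM2 h⁻¹ *
      SL2.toM2 ((translatedChart g).symm x))) (translatedChart g).target :=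
    chartCoord.contDiff.comp_contDiffOn
      (contDiffOn_const.mul (contDiffOn_translatedChart_symm g))
  refine (h1.congr fun x _ => translatedChart_apply h _).mono ?_
  rintro x ⟨hx, -⟩
  exact hx.1

lemma contMDiff_toM2 : ContMDiff 𝓘(ℂ, E3) 𝓘(ℂ, M2) ω SL2.toM2 := by
  intro g
  rw [contMDiffAt_iff_source, ModelWithCorners.range_eq_univ]
  refine ContMDiffAt.contMDiffWithinAt (contMDiffAt_iff_contDiffAt.2 ?_)
  exact (contDiffOn_translatedChart_symm g).contDiffAt
    ((translatedChart g).open_target.mem_nhds (mem_chart_target E3 g))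

/-- Maps into `SL(2, ℂ)` are holomorphic if their matrix entries are. -/
lemma contMDiff_of_toM2 {F N : Type*} [NormedAddCommGroup F] [NormedSpace ℂ F]
    [TopologicalSpace N] {HF : Type*} [TopologicalSpace HF] {J : ModelWithCorners ℂ F HF}
    [ChartedSpace HF N] {f : N → SL2}
    (hf : ContMDiff J 𝓘(ℂ, M2) ω fun x => (f x).toM2) : ContMDiff J 𝓘(ℂ, E3) ω f := by
  intro x
  rw [contMDiffAt_iff_target]
  refine ⟨(isInducing_toM2.continuous_iff.2 hf.continuous).continuousAt, ?_⟩
  have h1 : ContDiff ℂ ω fun m : M2 => chartCoord (SL2.toM2 (f x)⁻¹ * m) :=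
    chartCoord.contDiff.comp (contDiff_const.mul contDiff_id)
  have h2 : extChartAt 𝓘(ℂ, E3) (f x) ∘ f = fun y => chartCoord (SL2.toM2 (f x)⁻¹ * (f y).toM2) :=
    funext fun y => translatedChart_apply _ _
  rw [h2]
  exact (h1.contMDiff _).comp x (hf x)

lemma toM2_inv (m : SL2) : SL2.toM2 m⁻¹ = matrixOf (entry 1 1 m.toM2) (-entry 0 1 m.toM2)
    (-entry 1 0 m.toM2) (entry 0 0 m.toM2) := by
  refine M2.ext fun i j => ?_
  rw [entry_toM2, Matrix.SpecialLinearGroup.coe_inv, Matrix.adjugate_fin_two]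
  fin_cases i <;> fin_cases j <;> simp

instance : LieGroup 𝓘(ℂ, E3) ω SL2 where
  contMDiff_mul := by
    refine contMDiff_of_toM2 ?_
    have h : ContDiff ℂ ω fun z : M2 × M2 => z.1 * z.2 := contDiff_mul
    simp only [map_mul]
    exact h.contMDiff.comp ((contMDiff_toM2.comp contMDiff_fst).prodMk_space
      (contMDiff_toM2.comp contMDiff_snd))
  contMDiff_inv := by
    refine contMDiff_of_toM2 ?_
    have h : ContDiff ℂ ω fun m : M2 => matrixOf (entry 1 1 m) (-entry 0 1 m)
        (-entry 1 0 m) (entry 0 0 m) :=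
      contDiffOn_univ.1 (contDiffOn_matrixOf (entry 1 1).contDiff.contDiffOn
        (entry 0 1).contDiff.neg.contDiffOn (entry 1 0).contDiff.neg.contDiffOn
        (entry 0 0).contDiff.contDiffOn)
    simp only [toM2_inv]
    exact h.contMDiff.comp contMDiff_toM2

end SL2Manifold

/-! ### The adjoint representation -/

section AdjointRepresentation

variable {E : Type*} [NormedAddCommGroup E] [NormedSpace ℂ E]
  {G : Type*} [TopologicalSpace G] [ChartedSpace E G] [Group G]
  {R : Type*} [NormedRing R] [NormedAlgebra ℂ R]

namespace LinearRealization

variable (r : LinearRealization E G R)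

lemma lie_injective : Function.Injective r.lie := fun x y h => by
  rw [← r.coord_lie x, h, r.coord_lie]

variable [LieGroup 𝓘(ℂ, E) ω G]

lemma lie_Ad (a : G) (v : E) : r.lie (Ad a v) = r.toHom a * r.lie v * r.toHom a⁻¹ := by
  have hd : ∀ x, MDifferentiableAt 𝓘(ℂ, E) 𝓘(ℂ, R) r.toHom x :=
    r.contMDiff.mdifferentiable (by simp)
  have hc : MDifferentiableAt 𝓘(ℂ, E) 𝓘(ℂ, E) (fun x : G => a * x * a⁻¹) 1 :=
    ((contMDiff_mul_right (I := 𝓘(ℂ, E)) (n := ω) (a := a⁻¹)).comp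
      (contMDiff_mul_left (I := 𝓘(ℂ, E)) (n := ω) (a := a))).mdifferentiableAt (by simp)
  have h1 : mderiv E R r.toHom (a * 1 * a⁻¹) = r.lie := by
    rw [mul_one, mul_inv_cancel, r.mderiv_one]
  have h2 : Ad a v = mderiv E E (fun x : G => a * x * a⁻¹) 1 v := rfl
  let M : R →L[ℂ] R := (ContinuousLinearMap.mul ℂ R).flip (r.toHom a⁻¹) ∘L
    ContinuousLinearMap.mul ℂ R (r.toHom a)
  have h3 := mderiv_comp (g := M) (M.differentiableAt (x := r.toHom 1)).mdifferentiableAt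
    (hd 1) v
  rw [mderiv_eq_fderiv, M.fderiv, r.mderiv_one] at h3
  have h4 := mderiv_comp (f := fun x : G => a * x * a⁻¹) (hd _) hc v
  rw [h1] at h4
  simp only [map_mul] at h4
  rw [h2, ← h4]
  exact h3

lemma Ad_add (r : LinearRealization E G R) (a : G) (v w : E) :
    Ad a (v + w) = (Ad a v : E) + Ad a w :=
  r.lie_injective (by rw [map_add, r.lie_Ad, r.lie_Ad, r.lie_Ad, map_add, mul_add, add_mul])

lemma Ad_mul (r : LinearRealization E G R) (a b : G) (v : E) : Ad (a * b) v = Ad a (Ad b v : E) :=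
  r.lie_injective (by
    rw [r.lie_Ad, r.lie_Ad, r.lie_Ad, mul_inv_rev, map_mul, map_mul]
    simp only [mul_assoc])

lemma Ad_one (r : LinearRealization E G R) (v : E) : Ad (1 : G) v = v :=
  r.lie_injective (by rw [r.lie_Ad, inv_one, map_one, one_mul, mul_one])

lemma Ad_eq (a : G) (v : E) : Ad a v = r.coord (r.toHom a * r.lie v * r.toHom a⁻¹) := by
  rw [← r.lie_Ad, r.coord_lie]

end LinearRealization

end AdjointRepresentation

/-! ### The Lie algebra of `SL(2, ℂ)` -/

section SL2LieAlgebra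

lemma mdifferentiable_toM2 (x : SL2) : MDifferentiableAt 𝓘(ℂ, E3) 𝓘(ℂ, M2) SL2.toM2 x :=
  contMDiff_toM2.mdifferentiable (by simp) x

/-- In the chart around the identity, the derivative of the standard representation at the identity
is normalized. -/
lemma chartCoord_mderiv_toM2 (v : E3) : chartCoord (mderiv E3 M2 SL2.toM2 1 v) = v := by
  have h1 := mderiv_comp (g := chartCoord) (chartCoord.differentiableAt
    (x := SL2.toM2 1)).mdifferentiableAt (mdifferentiable_toM2 1) v
  rw [mderiv_eq_fderiv, chartCoord.fderiv] at h1
  rw [← h1]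
  have h2 : (fun z : SL2 => chartCoord z.toM2) = extChartAt 𝓘(ℂ, E3) (1 : SL2) := by
    funext z
    refine Eq.trans ?_ (translatedChart_apply 1 z).symm
    rw [inv_one, map_one, one_mul]
  rw [h2]
  exact LinearRealization.mderiv_chart_self 1 v

lemma entry_one : entry 0 0 1 = 1 ∧ entry 0 1 1 = 0 ∧ entry 1 0 1 = 0 ∧ entry 1 1 1 = 1 := by
  rw [← map_one SL2.toM2]
  simp only [entry_toM2]
  simp

/-- The derivative of the determinant at the identity is the trace. -/
lemma trace_mderiv_toM2 (v : E3) :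
    entry 0 0 (mderiv E3 M2 SL2.toM2 1 v) + entry 1 1 (mderiv E3 M2 SL2.toM2 1 v) = 0 := by
  let f : M2 → ℂ := fun m => entry 0 0 m * entry 1 1 m - entry 0 1 m * entry 1 0 m
  have hf : HasFDerivAt f _ (SL2.toM2 1) :=
    ((entry 0 0).hasFDerivAt.mul (entry 1 1).hasFDerivAt).sub
      ((entry 0 1).hasFDerivAt.mul (entry 1 0).hasFDerivAt)
  have h1 := mderiv_comp (g := f) hf.differentiableAt.mdifferentiableAt (mdifferentiable_toM2 1) v
  have h2 : (fun z : SL2 => f z.toM2) = fun _ => 1 := by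
    funext z
    simp only [f, entry_toM2]
    exact z.det_eq
  have h3 : mderiv E3 ℂ (fun _ : SL2 => (1 : ℂ)) 1 v = 0 :=
    congrArg (fun F : E3 →L[ℂ] ℂ => F v)
      (mfderiv_const (I := 𝓘(ℂ, E3)) (I' := 𝓘(ℂ, ℂ)) (c := (1 : ℂ)) (x := (1 : SL2)))
  rw [h2, h3, mderiv_eq_fderiv, hf.fderiv] at h1
  simp [entry_one] at h1
  linear_combination -h1

/-- The standard representation, as a realization of `SL(2, ℂ)`. -/
def SL2.realization : LinearRealization E3 SL2 M2 where
  toHom := SL2.toM2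
  lie := mderiv E3 M2 SL2.toM2 1
  coord := sl2Coord
  contMDiff := contMDiff_toM2
  mderiv_one := rfl
  coord_lie v := by
    have h1 := chartCoord_mderiv_toM2 v
    have h2 := trace_mderiv_toM2 v
    rw [sl2Coord_apply]
    conv_rhs => rw [← h1, chartCoord_apply]
    congr 4
    linear_combination (-Complex.I) * h2

/-- The cross product on `ℂ³`, which is the Lie bracket of `𝔰𝔩(2, ℂ)`. -/
def cross (x y : E3) : E3 :=
  !₂[x 1 * y 2 - x 2 * y 1, x 2 * y 0 - x 0 * y 2, x 0 * y 1 - x 1 * y 0]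

lemma entries_lie (v : E3) : entry 0 0 (SL2.realization.lie v) = -(Complex.I / 2) * v 2 ∧
    entry 0 1 (SL2.realization.lie v) = (-Complex.I * v 0 - v 1) / 2 ∧
    entry 1 0 (SL2.realization.lie v) = (-Complex.I * v 0 + v 1) / 2 ∧
    entry 1 1 (SL2.realization.lie v) = Complex.I / 2 * v 2 := by
  have h1 := chartCoord_mderiv_toM2 v
  have h2 := trace_mderiv_toM2 v
  change chartCoord (SL2.realization.lie v) = v at h1
  change entry 0 0 (SL2.realization.lie v) + entry 1 1 (SL2.realization.lie v) = 0 at h2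
  generalize SL2.realization.lie v = m at h1 h2
  rw [chartCoord_apply] at h1
  subst h1
  simp
  refine ⟨?_, ?_, ?_, ?_⟩
  · linear_combination (entry 0 0 m) * Complex.I_mul_I
  · linear_combination (entry 0 1 m + entry 1 0 m) / 2 * Complex.I_mul_I
  · linear_combination (entry 0 1 m + entry 1 0 m) / 2 * Complex.I_mul_I
  · linear_combination h2 - (entry 0 0 m) * Complex.I_mul_I

lemma bracket_eq_cross (x y : E3) : SL2.realization.bracket x y = cross x y := by
  obtain ⟨h1, h2, h3, h4⟩ := entries_lie x
  obtain ⟨k1, k2, k3, k4⟩ := entries_lie y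
  have hc : SL2.realization.coord = sl2Coord := rfl
  rw [LinearRealization.bracket, hc, sl2Coord_apply, cross]
  simp only [map_sub, entry_mul, h1, h2, h3, h4, k1, k2, k3, k4]
  congr 2
  · ring_nf
    simp only [Complex.I_sq]
    ring
  congr 1
  · ring_nf
    simp only [Complex.I_sq]
    ring
  congr 1
  · ring_nf
    simp only [Complex.I_sq]
    ring

end SL2LieAlgebra

/-! ### Block triangular operators -/

section BlockOperators

/-- Operators on `ℂ² × ℂ²`. -/
abbrev BlockOp : Type := ((Fin 2 → ℂ) × (Fin 2 → ℂ)) →L[ℂ] ((Fin 2 → ℂ) × (Fin 2 → ℂ))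

/-- The operator with the block matrix `(A B; 0 A)`. -/
def block : M2 × M2 →L[ℂ] BlockOp :=
  LinearMap.toContinuousLinearMap
    { toFun := fun z => (z.1 ∘L ContinuousLinearMap.fst ℂ _ _ +
        z.2 ∘L ContinuousLinearMap.snd ℂ _ _).prod (z.1 ∘L ContinuousLinearMap.snd ℂ _ _)
      map_add' := fun _ _ => ContinuousLinearMap.ext fun _ =>
        Prod.ext (add_add_add_comm _ _ _ _) rfl
      map_smul' := fun c z => ContinuousLinearMap.ext fun x =>
        Prod.ext (smul_add c (z.1 x.1) (z.2 x.2)).symm rfl }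

lemma block_apply (A B : M2) (p q : Fin 2 → ℂ) : block (A, B) (p, q) = (A p + B q, A q) := by
  rfl

lemma block_mul (A B C D : M2) : block (A, B) * block (C, D) = block (A * C, A * D + B * C) := by
  refine ContinuousLinearMap.ext fun ⟨p, q⟩ => ?_
  rw [mul_apply_eq_comp, block_apply, block_apply, block_apply]
  simp [add_assoc]

lemma block_one : block (1, 0) = 1 := by
  refine ContinuousLinearMap.ext fun ⟨p, q⟩ => ?_
  rw [block_apply]
  simp

/-- The blocks in the first row. -/
def unblock : BlockOp →L[ℂ] M2 × M2 :=
  LinearMap.toContinuousLinearMap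
    { toFun := fun T =>
        (ContinuousLinearMap.fst ℂ _ _ ∘L T ∘L ContinuousLinearMap.inl ℂ _ _,
          ContinuousLinearMap.fst ℂ _ _ ∘L T ∘L ContinuousLinearMap.inr ℂ _ _)
      map_add' := fun _ _ => rfl
      map_smul' := fun _ _ => rfl }

lemma unblock_block (z : M2 × M2) : unblock (block z) = z := by
  refine Prod.ext (ContinuousLinearMap.ext fun p => ?_) (ContinuousLinearMap.ext fun p => ?_)
  · change z.1 p + z.2 0 = z.1 p
    simp
  · change z.1 0 + z.2 p = z.2 p
    simp

end BlockOperators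

/-! ### The tangent group of `SL(2, ℂ)` -/

section TangentGroup

/-- The semidirect product of `SL(2, ℂ)` and its Lie algebra `ℂ³`, with respect to the adjoint
representation; it is the tangent group of `SL(2, ℂ)`. -/
def TSL2 : Type := SL2 × E3

namespace TSL2

/-- The group element `(a, v)`. -/
def mk (a : SL2) (v : E3) : TSL2 := (a, v)
/-- The projection to `SL(2, ℂ)`. -/
def base (p : TSL2) : SL2 := p.1
/-- The component in the Lie algebra. -/
def vec (p : TSL2) : E3 := p.2

@[ext] lemma ext {p q : TSL2} (h : p.base = q.base) (h' : p.vec = q.vec) : p = q := Prod.ext h h'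

instance : TopologicalSpace TSL2 := inferInstanceAs (TopologicalSpace (SL2 × E3))

instance : ChartedSpace (E3 × E3) TSL2 :=
  inferInstanceAs (ChartedSpace (ModelProd E3 E3) (SL2 × E3))

instance : SimplyConnectedSpace TSL2 :=
  simplyConnectedSpace_prod (X := SL2) (Y := E3)

instance : IsManifold 𝓘(ℂ, E3 × E3) ω TSL2 := by
  rw [modelWithCornersSelf_prod]
  exact inferInstanceAs (IsManifold (𝓘(ℂ, E3).prod 𝓘(ℂ, E3)) ω (SL2 × E3))

lemma contMDiff_base : ContMDiff 𝓘(ℂ, E3 × E3) 𝓘(ℂ, E3) ω base := by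
  rw [modelWithCornersSelf_prod]
  exact contMDiff_fst (I := 𝓘(ℂ, E3)) (J := 𝓘(ℂ, E3)) (M := SL2) (N := E3)

lemma contMDiff_vec : ContMDiff 𝓘(ℂ, E3 × E3) 𝓘(ℂ, E3) ω vec := by
  rw [modelWithCornersSelf_prod]
  exact contMDiff_snd (I := 𝓘(ℂ, E3)) (J := 𝓘(ℂ, E3)) (M := SL2) (N := E3)

lemma contMDiff_mk {F N HF : Type*} [NormedAddCommGroup F] [NormedSpace ℂ F] [TopologicalSpace HF]
    [TopologicalSpace N] {J : ModelWithCorners ℂ F HF} [ChartedSpace HF N]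
    {f : N → SL2} {g : N → E3}
    (hf : ContMDiff J 𝓘(ℂ, E3) ω f) (hg : ContMDiff J 𝓘(ℂ, E3) ω g) :
    ContMDiff J 𝓘(ℂ, E3 × E3) ω fun x => mk (f x) (g x) := by
  rw [modelWithCornersSelf_prod]
  exact hf.prodMk hg

lemma mderiv_base (p : TSL2) : mderiv (E3 × E3) E3 base p = ContinuousLinearMap.fst ℂ E3 E3 := by
  unfold mderiv
  rw [modelWithCornersSelf_prod]
  exact mfderiv_fst (I := 𝓘(ℂ, E3)) (I' := 𝓘(ℂ, E3)) (M := SL2) (M' := E3)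

lemma mderiv_vec (p : TSL2) : mderiv (E3 × E3) E3 vec p = ContinuousLinearMap.snd ℂ E3 E3 := by
  unfold mderiv
  rw [modelWithCornersSelf_prod]
  exact mfderiv_snd (I := 𝓘(ℂ, E3)) (I' := 𝓘(ℂ, E3)) (M := SL2) (M' := E3)

instance : Mul TSL2 := ⟨fun p q => mk (p.base * q.base) (p.vec + Ad p.base q.vec)⟩
instance : One TSL2 := ⟨mk 1 0⟩
instance : Inv TSL2 := ⟨fun p => mk p.base⁻¹ (-(Ad p.base⁻¹ p.vec : E3))⟩

@[simp] lemma base_mul (p q : TSL2) : (p * q).base = p.base * q.base := rfl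
@[simp] lemma vec_mul (p q : TSL2) : (p * q).vec = p.vec + Ad p.base q.vec := rfl
@[simp] lemma base_one : (1 : TSL2).base = 1 := rfl
@[simp] lemma vec_one : (1 : TSL2).vec = 0 := rfl
@[simp] lemma base_inv (p : TSL2) : (p⁻¹).base = p.base⁻¹ := rfl
@[simp] lemma vec_inv (p : TSL2) : (p⁻¹).vec = -(Ad p.base⁻¹ p.vec : E3) := rfl

instance : Group TSL2 := Group.ofLeftAxioms
  (fun p q s => by
    refine TSL2.ext (mul_assoc _ _ _) ?_
    simp only [vec_mul, base_mul, SL2.realization.Ad_add, SL2.realization.Ad_mul]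
    exact add_assoc _ _ _)
  (fun p => TSL2.ext (one_mul _) (by simp [SL2.realization.Ad_one]))
  (fun p => TSL2.ext (inv_mul_cancel _) (by simp))

lemma contMDiff_Ad {F N HF : Type*} [NormedAddCommGroup F] [NormedSpace ℂ F] [TopologicalSpace HF]
    [TopologicalSpace N] {J : ModelWithCorners ℂ F HF} [ChartedSpace HF N]
    {f : N → SL2} {g : N → E3}
    (hf : ContMDiff J 𝓘(ℂ, E3) ω f) (hg : ContMDiff J 𝓘(ℂ, E3) ω g) :
    ContMDiff J 𝓘(ℂ, E3) ω fun x => (Ad (f x) (g x) : E3) := by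
  have h1 : ContDiff ℂ ω fun z : M2 × E3 × M2 =>
      SL2.realization.coord (z.1 * SL2.realization.lie z.2.1 * z.2.2) :=
    SL2.realization.coord.contDiff.comp ((contDiff_fst.mul (SL2.realization.lie.contDiff.comp
      (contDiff_fst.comp contDiff_snd))).mul (contDiff_snd.comp contDiff_snd))
  have h2 : ContMDiff J 𝓘(ℂ, M2) ω fun x => SL2.toM2 (f x)⁻¹ :=
    contMDiff_toM2.comp hf.inv
  have h3 : ContMDiff J 𝓘(ℂ, M2) ω fun x => SL2.toM2 (f x) := contMDiff_toM2.comp hf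
  have h4 : ContMDiff J 𝓘(ℂ, M2 × E3 × M2) ω fun x => ((f x).toM2, g x, SL2.toM2 (f x)⁻¹) :=
    h3.prodMk_space (hg.prodMk_space h2)
  exact (h1.contMDiff.comp h4).congr fun x => SL2.realization.Ad_eq (f x) (g x)

instance : LieGroup 𝓘(ℂ, E3 × E3) ω TSL2 where
  contMDiff_mul := by
    have h1 := contMDiff_base.comp (contMDiff_fst (I := 𝓘(ℂ, E3 × E3)) (J := 𝓘(ℂ, E3 × E3))
      (n := ω) (M := TSL2) (N := TSL2))
    have h2 := contMDiff_base.comp (contMDiff_snd (I := 𝓘(ℂ, E3 × E3)) (J := 𝓘(ℂ, E3 × E3))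
      (n := ω) (M := TSL2) (N := TSL2))
    have h3 := contMDiff_vec.comp (contMDiff_fst (I := 𝓘(ℂ, E3 × E3)) (J := 𝓘(ℂ, E3 × E3))
      (n := ω) (M := TSL2) (N := TSL2))
    have h4 := contMDiff_vec.comp (contMDiff_snd (I := 𝓘(ℂ, E3 × E3)) (J := 𝓘(ℂ, E3 × E3))
      (n := ω) (M := TSL2) (N := TSL2))
    exact contMDiff_mk (h1.mul h2) (h3.add (contMDiff_Ad h1 h4))
  contMDiff_inv :=
    contMDiff_mk (contMDiff_base.inv) (contMDiff_Ad contMDiff_base.inv contMDiff_vec).neg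

/-- The block matrix `(a xa; 0 a)` of a matrix `a` and an element `x` of the Lie algebra. -/
def blockMap (z : M2 × E3) : BlockOp := block (z.1, SL2.realization.lie z.2 * z.1)

lemma contDiff_blockMap : ContDiff ℂ ω blockMap :=
  block.contDiff.comp (contDiff_fst.prodMk
    ((SL2.realization.lie.contDiff.comp contDiff_snd).mul contDiff_fst))

lemma fderiv_blockMap (z : M2 × E3) : fderiv ℂ blockMap (1, 0) z =
    block (z.1, SL2.realization.lie z.2) := by
  have h2 : HasFDerivAt (fun z : M2 × E3 => SL2.realization.lie z.2)
      (SL2.realization.lie ∘L ContinuousLinearMap.snd ℂ M2 E3) (1, 0) :=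
    (SL2.realization.lie ∘L ContinuousLinearMap.snd ℂ M2 E3).hasFDerivAt
  have h1 : HasFDerivAt (fun z : M2 × E3 => z.1) (ContinuousLinearMap.fst ℂ M2 E3) (1, 0) :=
    hasFDerivAt_fst
  have h3 : HasFDerivAt blockMap _ (1, 0) :=
    block.hasFDerivAt.comp ((1 : M2), (0 : E3)) (h1.prodMk (h2.mul' h1))
  rw [h3.fderiv]
  simp

/-- The block matrix `(a va; 0 a)` of a group element `(a, v)`. -/
def toBlock (p : TSL2) : BlockOp := blockMap (p.base.toM2, p.vec)

lemma contMDiff_pair : ContMDiff 𝓘(ℂ, E3 × E3) 𝓘(ℂ, M2 × E3) ω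
    fun p : TSL2 => (p.base.toM2, p.vec) :=
  (contMDiff_toM2.comp contMDiff_base).prodMk_space contMDiff_vec

/-- The derivative at the identity of the map that records the matrix of `a` and the vector `v` of a
group element `(a, v)`. -/
lemma mderiv_pair (z : E3 × E3) :
    mderiv (E3 × E3) (M2 × E3) (fun p : TSL2 => (p.base.toM2, p.vec)) 1 z =
      (SL2.realization.lie z.1, z.2) := by
  have h0 := contMDiff_pair.mdifferentiableAt (x := (1 : TSL2)) (by simp)
  have hb := contMDiff_base.mdifferentiableAt (x := (1 : TSL2)) (by simp)
  refine Prod.ext ?_ ?_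
  · have h1 := mderiv_comp (g := fun z : M2 × E3 => z.1)
      (differentiableAt_fst (p := (SL2.toM2 1, (0 : E3)))).mdifferentiableAt h0 z
    rw [mderiv_eq_fderiv, fderiv_fst] at h1
    have h2 := mderiv_comp (g := SL2.toM2) (mdifferentiable_toM2 (base 1)) hb z
    rw [mderiv_base] at h2
    exact h1.symm.trans h2
  · have h1 := mderiv_comp (g := fun z : M2 × E3 => z.2)
      (differentiableAt_snd (p := (SL2.toM2 1, (0 : E3)))).mdifferentiableAt h0 z
    rw [mderiv_eq_fderiv, fderiv_snd] at h1
    refine h1.symm.trans ?_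
    change mderiv (E3 × E3) E3 vec 1 z = z.2
    rw [mderiv_vec]
    rfl

/-- The representation `(a, v) ↦ (a va; 0 a)` on `ℂ² × ℂ²`, as a realization of `TSL2`. -/
def realization : LinearRealization (E3 × E3) TSL2 BlockOp where
  toHom :=
    { toFun := toBlock
      map_one' := by
        simp only [toBlock, blockMap, base_one, vec_one, map_one, map_zero, zero_mul, block_one]
      map_mul' := fun p q => by
        simp only [toBlock, blockMap, block_mul, base_mul, vec_mul, map_add, map_mul,
          SL2.realization.lie_Ad]
        congr 2
        have h : SL2.toM2 p.base⁻¹ * SL2.toM2 p.base = 1 := by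
          rw [← map_mul, inv_mul_cancel, map_one]
        have h' : SL2.realization.toHom = SL2.toM2 := rfl
        rw [h', add_mul, ← mul_assoc _ (SL2.toM2 p.base), mul_assoc _ (SL2.toM2 p.base⁻¹),
          ← mul_assoc (SL2.toM2 p.base⁻¹), h, one_mul, add_comm, mul_assoc] }
  lie := block ∘L (SL2.realization.lie.prodMap SL2.realization.lie)
  coord := (SL2.realization.coord.prodMap SL2.realization.coord) ∘L unblock
  contMDiff := contDiff_blockMap.contMDiff.comp contMDiff_pair
  mderiv_one := by
    refine ContinuousLinearMap.ext fun z => ?_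
    have h0 := contMDiff_pair.mdifferentiableAt (x := (1 : TSL2)) (by simp)
    have h1 := mderiv_comp (g := blockMap) (x := (1 : TSL2))
      ((contDiff_blockMap.differentiable (by simp) _).mdifferentiableAt) h0 z
    refine h1.trans ?_
    rw [mderiv_pair, mderiv_eq_fderiv]
    simp only [base_one, vec_one, map_one]
    exact fderiv_blockMap _
  coord_lie v := by
    change (SL2.realization.coord.prodMap SL2.realization.coord)
      (unblock (block (SL2.realization.lie.prodMap SL2.realization.lie v))) = v
    rw [unblock_block]
    exact Prod.ext (SL2.realization.coord_lie _) (SL2.realization.coord_lie _)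

lemma bracket_eq (z w : E3 × E3) :
    realization.bracket z w = (cross z.1 w.1, cross z.1 w.2 + cross z.2 w.1) := by
  have h : realization.bracket z w = (SL2.realization.coord.prodMap SL2.realization.coord)
      (unblock (block (SL2.realization.lie z.1, SL2.realization.lie z.2) *
        block (SL2.realization.lie w.1, SL2.realization.lie w.2) -
        block (SL2.realization.lie w.1, SL2.realization.lie w.2) *
        block (SL2.realization.lie z.1, SL2.realization.lie z.2))) := rfl
  rw [h, block_mul, block_mul, ← map_sub, unblock_block]
  simp only [← bracket_eq_cross]
  refine Prod.ext rfl ?_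
  refine Eq.trans ?_ (map_add SL2.realization.coord _ _)
  change SL2.realization.coord _ = _
  congr 1
  change (_ + _ : M2) - (_ + _) = (_ - _) + (_ - _)
  abel

lemma isAdjointSemidirectProduct : IsAdjointSemidirectProduct E3 SL2 (E3 × E3) TSL2 := by
  refine ⟨{ toFun := fun z => mk z.1 z.2
            invFun := fun p => (p.base, p.vec)
            left_inv := fun _ => rfl
            right_inv := fun _ => rfl
            contMDiff_toFun := ?_
            contMDiff_invFun := ?_ }, fun a b v w => rfl⟩
  · exact contMDiff_mk contMDiff_fst contMDiff_snd
  · exact contMDiff_base.prodMk contMDiff_vec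

end TSL2

end TangentGroup

/-! ### Identities for the cross product -/

section CrossProduct

/-- The standard basis of `ℂ³`. -/
def stdVec (i : Fin 3) : E3 := EuclideanSpace.single i 1

lemma cross_apply (x y : E3) : cross x y 0 = x 1 * y 2 - x 2 * y 1 ∧
    cross x y 1 = x 2 * y 0 - x 0 * y 2 ∧ cross x y 2 = x 0 * y 1 - x 1 * y 0 :=
  ⟨rfl, rfl, rfl⟩

lemma E3.ext {x y : E3} (h0 : x 0 = y 0) (h1 : x 1 = y 1) (h2 : x 2 = y 2) : x = y := by
  ext i
  fin_cases i <;> assumption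

lemma cross_zero (x : E3) : cross x 0 = 0 := E3.ext (by simp [cross_apply])
  (by simp [cross_apply]) (by simp [cross_apply])

lemma zero_cross (x : E3) : cross 0 x = 0 := E3.ext (by simp [cross_apply])
  (by simp [cross_apply]) (by simp [cross_apply])

lemma smul_cross (c : ℂ) (x y : E3) : cross (c • x) y = c • cross x y :=
  E3.ext (by simp [cross_apply]; ring) (by simp [cross_apply]; ring) (by simp [cross_apply]; ring)

lemma cross_smul (c : ℂ) (x y : E3) : cross x (c • y) = c • cross x y :=
  E3.ext (by simp [cross_apply]; ring) (by simp [cross_apply]; ring) (by simp [cross_apply]; ring)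

lemma cross_anticomm (x y : E3) : cross y x = -cross x y :=
  E3.ext (by simp [cross_apply]; ring) (by simp [cross_apply]; ring) (by simp [cross_apply]; ring)

/-- Every vector of the standard basis occurs twice, up to sign, among the brackets of the frame. -/
lemma sum_inner_cross (x y : E3) :
    ∑ i, ∑ j, inner ℂ y (cross (stdVec i) (stdVec j)) * inner ℂ (cross (stdVec i) (stdVec j)) x
      = 2 * inner ℂ y x := by
  simp [Fin.sum_univ_three, PiLp.inner_apply, cross_apply, stdVec]
  ring

lemma sum_smul_cross (x : E3) :
    cross (x 0 • stdVec 1) (stdVec 2) + cross (x 1 • stdVec 2) (stdVec 0) +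
      cross (x 2 • stdVec 0) (stdVec 1) = x :=
  E3.ext (by simp [cross_apply, stdVec]) (by simp [cross_apply, stdVec])
    (by simp [cross_apply, stdVec])

end CrossProduct

/-! ### The static metric on `SL(2, ℂ)` -/

section StaticMetric

/-- The left-invariant metric on `SL(2, ℂ)` for which the standard basis of `ℂ³` is orthonormal. -/
def SL2.staticMetric : HermitianMetric E3 SL2 :=
  SL2.realization.leftInvariantMetric (ContinuousLinearEquiv.refl ℂ E3)

lemma SL2.isStatic_staticMetric : IsStatic SL2.staticMetric := by
  refine ⟨1, fun x u v => ?_⟩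
  have h := SL2.realization.Theta_leftInvariantMetric (ContinuousLinearEquiv.refl ℂ E3) stdVec
    (EuclideanSpace.basisFun (Fin 3) ℂ) (fun i => EuclideanSpace.basisFun_apply _ _ i) x u v
  refine h.trans ?_
  rw [LinearRealization.thetaForm]
  simp only [bracket_eq_cross, ContinuousLinearEquiv.refl_apply, sum_inner_cross]
  rw [← mul_assoc, one_div, inv_mul_cancel₀ two_ne_zero, Complex.ofReal_one]
  rfl

end StaticMetric

/-! ### Two solitons on the tangent group -/

namespace TSL2

/-- The shear `(x, v) ↦ (x, v - t x)`, with values in the orthogonal direct sum. In the metric that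
it induces, the abelian ideal is orthogonal to the subspace of the vectors `(x, t x)`. -/
def twist (t : ℂ) : (E3 × E3) ≃L[ℂ] WithLp 2 (E3 × E3) :=
  (ContinuousLinearEquiv.skewProd (ContinuousLinearEquiv.refl ℂ E3)
    (ContinuousLinearEquiv.refl ℂ E3) (-(t • ContinuousLinearMap.id ℂ E3))).trans
      (WithLp.prodContinuousLinearEquiv 2 ℂ E3 E3).symm

lemma inner_twist (t : ℂ) (z w : E3 × E3) :
    inner ℂ (twist t z) (twist t w) =
      inner ℂ z.1 w.1 + inner ℂ (z.2 - t • z.1) (w.2 - t • w.1) := by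
  rw [WithLp.prod_inner_apply]
  simp only [sub_eq_add_neg]
  rfl

/-- An orthonormal frame for the metric with parameter `t`. -/
def twistFrame (t : ℂ) : Fin 3 ⊕ Fin 3 → E3 × E3 :=
  Sum.elim (fun i => (stdVec i, t • stdVec i)) (fun i => (0, stdVec i))

/-- The image of the frame under `twist t`, which does not depend on `t`. -/
def twistBasis : OrthonormalBasis (Fin 3 ⊕ Fin 3) ℂ (WithLp 2 (E3 × E3)) :=
  (EuclideanSpace.basisFun (Fin 3) ℂ).prod (EuclideanSpace.basisFun (Fin 3) ℂ)

lemma twistBasis_eq (t : ℂ) (i : Fin 3 ⊕ Fin 3) : twistBasis i = twist t (twistFrame t i) := by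
  rcases i with i | i
  · simp [twistBasis, twist, twistFrame, stdVec]
  · simp [twistBasis, twist, twistFrame, stdVec]

/-- The left-invariant metric on `TSL2` for which `twist t` is an isometry at the identity. -/
def twistMetric (t : ℂ) : HermitianMetric (E3 × E3) TSL2 :=
  realization.leftInvariantMetric (twist t)

lemma twistMetric_form_one (t : ℂ) (z w : E3 × E3) : (twistMetric t).form 1 z w =
    inner ℂ w.1 z.1 + inner ℂ (w.2 - t • w.1) (z.2 - t • z.1) :=
  (realization.leftInvariantMetric_form_one (twist t) z w).trans (inner_twist t w z)

/-- With `c = e i × e j`, the brackets of the frame are `(c, 2 t c)`, twice `(0, c)`, and `0`; the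
isometry `twist t` takes the first of these to `(c, t c)`. -/
lemma thetaForm_twist (t : ℂ) (z w : E3 × E3) :
    realization.thetaForm (twist t) (twistFrame t) z w =
      inner ℂ (w.1 + conj t • (w.2 - t • w.1)) (z.1 + conj t • (z.2 - t • z.1))
        + 2 * inner ℂ (w.2 - t • w.1) (z.2 - t • z.1) := by
  set p := w.2 - t • w.1 with hp
  set q := z.2 - t • z.1 with hq
  have key : ∀ a c : E3, inner ℂ (twist t w) (twist t (a, t • a + c)) =
      inner ℂ w.1 a + inner ℂ p c := by
    intro a c
    rw [inner_twist, add_sub_cancel_left]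
  have key' : ∀ a c : E3, inner ℂ (twist t (a, t • a + c)) (twist t z) =
      inner ℂ a z.1 + inner ℂ c q := by
    intro a c
    rw [inner_twist, add_sub_cancel_left]
  have b1 : ∀ i j, realization.bracket (stdVec i, t • stdVec i) (stdVec j, t • stdVec j) =
      (cross (stdVec i) (stdVec j), t • cross (stdVec i) (stdVec j) +
        t • cross (stdVec i) (stdVec j)) := fun i j => by
    rw [bracket_eq, cross_smul, smul_cross]
  have b2 : ∀ i j, realization.bracket (stdVec i, t • stdVec i) (0, stdVec j) =
      (0, t • 0 + cross (stdVec i) (stdVec j)) := fun i j => by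
    rw [bracket_eq, cross_zero, cross_zero, smul_zero, zero_add, add_zero]
  have b3 : ∀ i j, realization.bracket (0, stdVec i) (stdVec j, t • stdVec j) =
      (0, t • 0 + cross (stdVec i) (stdVec j)) := fun i j => by
    rw [bracket_eq, zero_cross, zero_cross, smul_zero, zero_add]
  have b4 : ∀ i j, realization.bracket (0, stdVec i) (0, stdVec j) = (0, 0) := fun i j => by
    rw [bracket_eq, zero_cross, zero_cross, cross_zero, add_zero]
  have c1 : ∀ c : E3, inner ℂ w.1 c + inner ℂ p (t • c) = inner ℂ (w.1 + conj t • p) c := by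
    intro c
    rw [inner_add_left, inner_smul_left, inner_smul_right, Complex.conj_conj]
  have c2 : ∀ c : E3, inner ℂ c z.1 + inner ℂ (t • c) q = inner ℂ c (z.1 + conj t • q) := by
    intro c
    rw [inner_add_right, inner_smul_left, inner_smul_right]
  have k0 : twist t (0, 0) = 0 := map_zero _
  rw [LinearRealization.thetaForm]
  simp only [Fintype.sum_sum_type, twistFrame, Sum.elim_inl, Sum.elim_inr, b1, b2, b3, b4, k0, key,
    key', c1, c2, inner_zero_left, inner_zero_right, zero_add, mul_zero, Finset.sum_const_zero,
    add_zero, Finset.sum_add_distrib, sum_inner_cross]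
  ring

lemma Theta_twistMetric_one (t : ℂ) (z w : E3 × E3) : Theta (twistMetric t) 1 z w =
    realization.thetaForm (twist t) (twistFrame t) z w := by
  have h := realization.Theta_leftInvariantMetric (twist t) (twistFrame t) twistBasis
    (twistBasis_eq t) 1 z w
  rw [LinearRealization.toOne_one, LinearRealization.toOne_one] at h
  exact h

lemma lie_eq (z w : E3 × E3) :
    Bracket.bracket (L := GroupLieAlgebra 𝓘(ℂ, E3 × E3) TSL2)
      (M := GroupLieAlgebra 𝓘(ℂ, E3 × E3) TSL2) z w =
        (cross z.1 w.1, cross z.1 w.2 + cross z.2 w.1) :=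
  (realization.lieBracket_eq_bracket z w).trans (bracket_eq z w)

/-- The derivation `(x, v) ↦ (0, c v)`. -/
def fiberScaling (c : ℂ) : LieDerivation ℂ (GroupLieAlgebra 𝓘(ℂ, E3 × E3) TSL2)
    (GroupLieAlgebra 𝓘(ℂ, E3 × E3) TSL2) where
  toFun z := ((0, c • (z : E3 × E3).2) : E3 × E3)
  map_add' z w := Prod.ext (add_zero (0 : E3)).symm (smul_add c (z : E3 × E3).2 (w : E3 × E3).2)
  map_smul' a z := Prod.ext (smul_zero a).symm (smul_comm c a (z : E3 × E3).2)
  leibniz' z w := by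
    have h1 := lie_eq z w
    have h2 := lie_eq z (0, c • (w : E3 × E3).2)
    have h3 := lie_eq w (0, c • (z : E3 × E3).2)
    have h4 : ((0, c • (cross (z : E3 × E3).1 (w : E3 × E3).2 +
        cross (z : E3 × E3).2 (w : E3 × E3).1)) : E3 × E3) =
      (cross (z : E3 × E3).1 0, cross (z : E3 × E3).1 (c • (w : E3 × E3).2) +
        cross (z : E3 × E3).2 0) - (cross (w : E3 × E3).1 0,
          cross (w : E3 × E3).1 (c • (z : E3 × E3).2) + cross (w : E3 × E3).2 0) := by
      rw [cross_anticomm (w : E3 × E3).1 (z : E3 × E3).2]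
      simp [cross_zero, cross_smul, sub_eq_add_neg]
    exact (congrArg (fun x : E3 × E3 => ((0, c • x.2) : E3 × E3)) h1).trans
      (h4.trans (congrArg₂ (fun x y : E3 × E3 => x - y) h2 h3).symm)

lemma solitonEquation_fiberScaling {t c : ℂ} {lam : ℝ}
    (h : ∀ z w : E3 × E3, realization.thetaForm (twist t) (twistFrame t) z w =
      lam * (inner ℂ w.1 z.1 + inner ℂ (w.2 - t • w.1) (z.2 - t • z.1)) +
        (1 / 2) * (inner ℂ (w.2 - t • w.1) (c • z.2) + inner ℂ (c • w.2) (z.2 - t • z.1))) :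
    SolitonEquation (twistMetric t) lam (fiberScaling c) := by
  intro z w
  refine (Theta_twistMetric_one t z w).trans ((h z w).trans ?_)
  have h1 := twistMetric_form_one t z w
  have h2 := twistMetric_form_one t (0, c • (z : E3 × E3).2) w
  have h3 := twistMetric_form_one t z (0, c • (w : E3 × E3).2)
  simp only [inner_zero_left, inner_zero_right, smul_zero, sub_zero, zero_add] at h2 h3
  rw [← h1, ← h2, ← h3]
  rfl

lemma solitonEquation_twistMetric_zero : SolitonEquation (twistMetric 0) 1 (fiberScaling 1) := by
  refine solitonEquation_fiberScaling fun z w => ?_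
  rw [thetaForm_twist]
  simp
  ring

lemma solitonEquation_twistMetric_one : SolitonEquation (twistMetric 1) 1 (fiberScaling 2) := by
  refine solitonEquation_fiberScaling fun z w => ?_
  rw [thetaForm_twist]
  simp
  ring

lemma isAlgebraicSoliton_twistMetric_zero : IsAlgebraicSoliton (twistMetric 0) := by
  refine ⟨realization.isLeftInvariant_leftInvariantMetric _, 1, fiberScaling 1, fiberScaling 1,
    solitonEquation_twistMetric_zero, fun z w => ?_⟩
  have h2 := twistMetric_form_one 0 (0, (1 : ℂ) • (z : E3 × E3).2) w
  have h3 := twistMetric_form_one 0 z (0, (1 : ℂ) • (w : E3 × E3).2)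
  refine h2.trans (Eq.trans ?_ h3.symm)
  simp

lemma isPerfect : IsPerfect (E3 × E3) TSL2 := by
  rw [IsPerfect, eq_top_iff]
  intro z _
  have hm : ∀ x y : E3 × E3, (cross x.1 y.1, cross x.1 y.2 + cross x.2 y.1) ∈
      ⁅(⊤ : LieIdeal ℂ (GroupLieAlgebra 𝓘(ℂ, E3 × E3) TSL2)),
        (⊤ : LieIdeal ℂ (GroupLieAlgebra 𝓘(ℂ, E3 × E3) TSL2))⁆ := fun x y => by
    have h : Bracket.bracket (L := GroupLieAlgebra 𝓘(ℂ, E3 × E3) TSL2)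
        (M := GroupLieAlgebra 𝓘(ℂ, E3 × E3) TSL2) x y ∈
          ⁅(⊤ : LieIdeal ℂ (GroupLieAlgebra 𝓘(ℂ, E3 × E3) TSL2)),
            (⊤ : LieIdeal ℂ (GroupLieAlgebra 𝓘(ℂ, E3 × E3) TSL2))⁆ :=
      LieSubmodule.lie_mem_lie trivial trivial
    rwa [lie_eq] at h
  let f : Fin 3 → Fin 3 → Fin 3 → E3 × E3 := fun k i j =>
    (cross ((z : E3 × E3).1 k • stdVec i) (stdVec j),
      cross ((z : E3 × E3).2 k • stdVec i) (stdVec j))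
  have hf : ∀ k i j, f k i j ∈ ⁅(⊤ : LieIdeal ℂ (GroupLieAlgebra 𝓘(ℂ, E3 × E3) TSL2)),
      (⊤ : LieIdeal ℂ (GroupLieAlgebra 𝓘(ℂ, E3 × E3) TSL2))⁆ := fun k i j => by
    have h := hm ((z : E3 × E3).1 k • stdVec i, (z : E3 × E3).2 k • stdVec i) (stdVec j, 0)
    rw [cross_zero, zero_add] at h
    exact h
  have hz : f 0 1 2 + f 1 2 0 + f 2 0 1 = z :=
    Prod.ext (sum_smul_cross (z : E3 × E3).1) (sum_smul_cross (z : E3 × E3).2)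
  exact hz ▸ add_mem (add_mem (hf 0 1 2) (hf 1 2 0)) (hf 2 0 1)

/-- The endomorphism that corresponds to `Θ` under the metric with parameter `1`. -/
def ricciOp (z : E3 × E3) : E3 × E3 := (z.2, (4 : ℂ) • z.2 - (2 : ℂ) • z.1)

lemma thetaForm_twist_zero (z w : E3 × E3) : realization.thetaForm (twist 0) (twistFrame 0) z w =
    inner ℂ (twist 0 w) (twist 0 (z.1, (2 : ℂ) • z.2)) := by
  rw [thetaForm_twist, inner_twist]
  simp

lemma thetaForm_twist_one (z w : E3 × E3) : realization.thetaForm (twist 1) (twistFrame 1) z w =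
    inner ℂ (twist 1 w) (twist 1 (ricciOp z)) := by
  rw [thetaForm_twist, inner_twist]
  simp [ricciOp]
  ring

lemma twist_nondegenerate (t : ℂ) {z z' : E3 × E3}
    (h : ∀ w, inner ℂ (twist t w) (twist t z) = inner ℂ (twist t w) (twist t z')) : z = z' :=
  (twist t).injective (ext_inner_left ℂ fun v => by
    have := h ((twist t).symm v)
    rwa [ContinuousLinearEquiv.apply_symm_apply] at this)

/-- The endomorphism that corresponds to `Θ` under the metric with parameter `0` has eigenvalues `1`
and `2`. A homothety with factor `c` carries them to eigenvalues `1/c` and `2/c` of `ricciOp`, whose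
minimal polynomial is `X² - 4X + 2`; but the roots `2 ± √2` of this polynomial do not have ratio
`2`. -/
lemma not_homothetic : ¬ Homothetic (twistMetric 0) (twistMetric 1) := by
  intro h
  obtain ⟨T, c, hc, hT, hθ⟩ := realization.exists_linearEquiv_of_homothetic (twist 0) (twistFrame 0)
    twistBasis (twistBasis_eq 0) (twist 1) (twistFrame 1) twistBasis (twistBasis_eq 1) h
  have hc' : (c : ℂ) ≠ 0 := by exact_mod_cast hc.ne'
  have key : ∀ z : E3 × E3, (c : ℂ) • ricciOp (T z) = T (z.1, (2 : ℂ) • z.2) := by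
    intro z
    refine twist_nondegenerate 1 fun w => ?_
    obtain ⟨w, rfl⟩ := T.surjective w
    rw [map_smul, inner_smul_right, ← thetaForm_twist_one, hθ, thetaForm_twist_zero, hT]
  have quad : ∀ (s : ℂ) (z : E3 × E3), z ≠ 0 → (c : ℂ) • ricciOp (T z) = s • T z →
      s ^ 2 - 4 * c * s + 2 * c ^ 2 = 0 := by
    intro s z hz h
    have h1 : (c : ℂ) • (T z).2 = s • (T z).1 := congrArg Prod.fst h
    have h2 : (c : ℂ) • ((4 : ℂ) • (T z).2 - (2 : ℂ) • (T z).1) = s • (T z).2 := congrArg Prod.snd h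
    have h3 : (s ^ 2 - 4 * c * s + 2 * c ^ 2) • (T z).1 = 0 := by
      refine PiLp.ext fun i => ?_
      have h1i := congrArg (fun x : E3 => x i) h1
      have h2i := congrArg (fun x : E3 => x i) h2
      simp only [PiLp.smul_apply, PiLp.sub_apply, PiLp.zero_apply, smul_eq_mul] at h1i h2i ⊢
      linear_combination (4 * (c : ℂ) - s) * h1i - (c : ℂ) * h2i
    refine (smul_eq_zero.1 h3).resolve_right fun h0 => hz ?_
    rw [h0, smul_zero] at h1
    exact T.map_eq_zero_iff.1 (Prod.ext h0 ((smul_eq_zero.1 h1).resolve_left hc'))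
  have hne : stdVec 0 ≠ 0 := by simp [stdVec]
  have q1 := quad 1 (stdVec 0, 0) (fun h => hne (congrArg Prod.fst h)) (by
    rw [key, smul_zero, one_smul])
  have q2 := quad 2 (0, stdVec 0) (fun h => hne (congrArg Prod.snd h)) (by
    rw [key, ← map_smul, Prod.smul_mk, smul_zero])
  -- the difference of the two quadratic equations is linear in `c`
  have h3 : (c : ℂ) = 3 / 4 := by linear_combination (q2 - q1) / (-4)
  rw [h3] at q1
  norm_num at q1

/-- The Leibniz rule on the abelian ideal, where the bracket vanishes. -/
lemma leibniz (D : LieDerivation ℂ (GroupLieAlgebra 𝓘(ℂ, E3 × E3) TSL2)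
    (GroupLieAlgebra 𝓘(ℂ, E3 × E3) TSL2)) (x y : E3) :
    cross x (D ((0, y) : E3 × E3) : E3 × E3).1 -
      cross y (D ((0, x) : E3 × E3) : E3 × E3).1 = 0 := by
  set a : E3 × E3 := (0, x)
  set b : E3 × E3 := (0, y)
  have h0 : Bracket.bracket (L := GroupLieAlgebra 𝓘(ℂ, E3 × E3) TSL2)
      (M := GroupLieAlgebra 𝓘(ℂ, E3 × E3) TSL2) a b = (0 : E3 × E3) := by
    rw [lie_eq]
    simp only [a, b, zero_cross, cross_zero, add_zero]
    rfl
  have h := D.apply_lie_eq_sub a b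
  have h1 : (D (0 : E3 × E3) : E3 × E3) = 0 := map_zero D
  have h2 := (congrArg (fun z : E3 × E3 => (D z : E3 × E3)) h0).symm.trans
    (h.trans (congrArg₂ (fun z w : E3 × E3 => z - w) (lie_eq a (D b)) (lie_eq b (D a))))
  have h3 := congrArg Prod.snd (h1.symm.trans h2)
  refine Eq.trans ?_ h3.symm
  simp [a, b, zero_cross]

/-- If `D` and its adjoint `D'` are derivations, then so is `(D + D') / 2`, which by the soliton
equation equals `ricciOp - lam`. The latter maps `(0, v)` to `(v, (4 - lam) v)`, so that the Leibniz
rule for `[(0, v), (0, w)] = 0` would yield `2 v × w = 0`. -/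
lemma not_isAlgebraicSoliton_twistMetric_one : ¬ IsAlgebraicSoliton (twistMetric 1) := by
  rintro ⟨-, lam, D, D', hS, hD⟩
  have hl := leibniz D (stdVec 0) (stdVec 1)
  have hl' := leibniz D' (stdVec 0) (stdVec 1)
  let d : E3 × E3 → E3 × E3 := D
  let d' : E3 × E3 → E3 × E3 := D'
  have hd : ∀ z w, inner ℂ (twist 1 w) (twist 1 (d z)) = inner ℂ (twist 1 (d' w)) (twist 1 z) :=
    fun z w => (realization.leftInvariantMetric_form_one (twist 1) (d z) w).symm.trans
      ((hD z w).trans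
      (realization.leftInvariantMetric_form_one (twist 1) z (d' w)))
  have hd' : ∀ z w, inner ℂ (twist 1 (d w)) (twist 1 z) = inner ℂ (twist 1 w) (twist 1 (d' z)) := by
    intro z w
    rw [← inner_conj_symm, hd, inner_conj_symm]
  have key : ∀ z : E3 × E3, ricciOp z = (lam : ℂ) • z + (1 / 2 : ℂ) • (d z + d' z) := by
    intro z
    refine twist_nondegenerate 1 fun w => ?_
    have h1 := (Theta_twistMetric_one 1 z w).symm.trans (hS z w)
    have h2 := realization.leftInvariantMetric_form_one (twist 1) z w
    have h3 := realization.leftInvariantMetric_form_one (twist 1) (d z) w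
    have h4 := realization.leftInvariantMetric_form_one (twist 1) z (d w)
    rw [hd'] at h4
    rw [← thetaForm_twist_one]
    refine (h1.trans (congrArg₂ (fun x y : ℂ => lam * x + 1 / 2 * y) h2
      (congrArg₂ (fun x y : ℂ => x + y) h3 h4))).trans ?_
    simp only [map_add, map_smul, inner_add_right, inner_smul_right]
  have k0 := congrArg Prod.fst (key (0, stdVec 0))
  have k1 := congrArg Prod.fst (key (0, stdVec 1))
  change stdVec 0 = (lam : ℂ) • 0 + (1 / 2 : ℂ) • ((d (0, stdVec 0)).1 + (d' (0, stdVec 0)).1) at k0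
  change stdVec 1 = (lam : ℂ) • 0 + (1 / 2 : ℂ) • ((d (0, stdVec 1)).1 + (d' (0, stdVec 1)).1) at k1
  change cross (stdVec 0) (d (0, stdVec 1)).1 - cross (stdVec 1) (d (0, stdVec 0)).1 = 0 at hl
  change cross (stdVec 0) (d' (0, stdVec 1)).1 - cross (stdVec 1) (d' (0, stdVec 0)).1 = 0 at hl'
  -- the third component of `2 e₀ × e₁`
  have e1 := congrArg (fun x : E3 => x 2) hl
  have e2 := congrArg (fun x : E3 => x 2) hl'
  have e3 := congrArg (fun x : E3 => x 0) k0
  have e4 := congrArg (fun x : E3 => x 1) k1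
  simp [cross_apply, stdVec] at e1 e2 e3 e4
  have : (2 : ℂ) = 0 := by
    linear_combination e3 + e4 + e1 / 2 + e2 / 2
  exact two_ne_zero this

end TSL2
end HCF

end

theorem theorem1p2 :
    ∃ (n : ℕ)
      -- a simply connected complex Lie group `H` of dimension `n`
      (H : Type) (_ : TopologicalSpace H) (_ : ChartedSpace (EuclideanSpace ℂ (Fin n)) H)
      (_ : Group H) (_ : LieGroup 𝓘(ℂ, EuclideanSpace ℂ (Fin n)) ω H)
      -- a simply connected complex Lie group `G` of dimension `2 n`
      (G : Type) (_ : TopologicalSpace G)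
      (_ : ChartedSpace (EuclideanSpace ℂ (Fin n) × EuclideanSpace ℂ (Fin n)) G)
      (_ : Group G)
      (_ : LieGroup 𝓘(ℂ, EuclideanSpace ℂ (Fin n) × EuclideanSpace ℂ (Fin n)) ω G),
      SimplyConnectedSpace H ∧
      SimplyConnectedSpace G ∧
      (∃ g₀ : HCF.HermitianMetric (EuclideanSpace ℂ (Fin n)) H,
        HCF.IsLeftInvariant g₀ ∧ HCF.IsStatic g₀) ∧
      HCF.IsAdjointSemidirectProduct (EuclideanSpace ℂ (Fin n)) H
        (EuclideanSpace ℂ (Fin n) × EuclideanSpace ℂ (Fin n)) G ∧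
      HCF.IsPerfect (EuclideanSpace ℂ (Fin n) × EuclideanSpace ℂ (Fin n)) G ∧
      ∃ g₁ g₂ : HCF.HermitianMetric
          (EuclideanSpace ℂ (Fin n) × EuclideanSpace ℂ (Fin n)) G,
        HCF.IsSemiAlgebraicSoliton g₁ ∧ HCF.IsSemiAlgebraicSoliton g₂ ∧
        ¬ HCF.Homothetic g₁ g₂ ∧
        HCF.IsAlgebraicSoliton g₁ ∧ ¬ HCF.IsAlgebraicSoliton g₂ := by
  refine ⟨3, HCF.SL2, inferInstance, inferInstance, inferInstance, inferInstance,
    HCF.TSL2, inferInstance, inferInstance, inferInstance, inferInstance,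
    inferInstance, inferInstance, ⟨HCF.SL2.staticMetric, ?_, HCF.SL2.isStatic_staticMetric⟩,
    HCF.TSL2.isAdjointSemidirectProduct, HCF.TSL2.isPerfect,
    HCF.TSL2.twistMetric 0, HCF.TSL2.twistMetric 1,
    ⟨HCF.TSL2.isAlgebraicSoliton_twistMetric_zero.1, 1, _,
      HCF.TSL2.solitonEquation_twistMetric_zero⟩,
    ⟨HCF.TSL2.realization.isLeftInvariant_leftInvariantMetric _, 1, _,
      HCF.TSL2.solitonEquation_twistMetric_one⟩,
    HCF.TSL2.not_homothetic, HCF.TSL2.isAlgebraicSoliton_twistMetric_zero,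
    HCF.TSL2.not_isAlgebraicSoliton_twistMetric_one⟩
  exact HCF.SL2.realization.isLeftInvariant_leftInvariantMetric _
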